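/- **Theorem 4.2.** Let $\|\cdot\|$ be an admissible norm on $\mathbb{R}^3$, i.e. a norm whose unit sphere $\partial B=\{x:\|x\|=1\}$ is a smooth ($C^\infty$) embedded surface with strictly positive Gaussian curvature with respect to the usual Euclidean structure of $\mathbb{R}^3$. A Birkhoff normal field of $\partial B$ is a continuous map $\eta:\partial B\to\mathbb{R}^3$ such that, for all $p\in\partial B$, $\|\eta(p)\|=1$ and $\|\eta(p)+tw\|\ge\|\eta(p)\|$ for all $w\in T_p\partial B$, $t\in\mathbb{R}$. A smooth vector field $\zeta$ along $\partial B$ is an affine normal field of $\partial B$ if it is transversal ($\zeta(p)\notin T_p\partial B$), equiaffine ($D_X\zeta$ is tangential for every tangent $X$), and $$|\det[X,Y,\zeta]|=\left|\det\begin{pmatrix}h(X,X)&h(X,Y)\\ h(Y,X)&h(Y,Y)\end{pmatrix}\right|^{1/2}$$ for all tangent vectors $X,Y$ at each point, where $\det$ is the usual determinant of $\mathbb{R}^3$ and $h$ is the affine fundamental form given by the Gauss equation $D_XY=\nabla_XY+h(X,Y)\zeta$ with $\nabla_XY$ tangential. Then the position vector $p\mapsto p$ is a Birkhoff normal field of $\partial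 B$. Moreover, for every Birkhoff normal field $\eta$ of $\partial B$: 1. $\eta$ is an affine normal field of $\partial B$ if and only if $\|\cdot\|$ is derived from an inner product for which the Gram matrix of the standard basis of $\mathbb{R}^3$ has determinant $1$; 2. some constant positive multiple $r\eta$ ($r>0$) of $\eta$ is an affine normal field of $\partial B$ if and only if $\|\cdot\|$ is derived from an inner product. -/

import Mathlib

open scoped ContDiff

/-- The parameter plane. -/
abbrev E2 : Type := EuclideanSpace ℝ (Fin 2)

/-- Euclidean three-space, with its usual inner product `inner ℝ`. -/
abbrev E3 : Type := EuclideanSpace ℝ (Fin 3)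

/-- The usual determinant `det[a, b, c]` of three vectors. -/
noncomputable def det3 (a b c : E3) : ℝ :=
  (Matrix.of ![a.ofLp, b.ofLp, c.ofLp]).det

/-- The usual cross product. -/
noncomputable def cross3 (a b : E3) : E3 :=
  WithLp.toLp 2 (crossProduct a.ofLp b.ofLp)

/-! ### Smooth surfaces in space -/

/-- `φ : U → S` is a smooth local parametrization of `S`: `U` is an open subset of the plane, `φ` is
a smooth immersion on `U`, and it is a homeomorphism of `U` onto a relatively open subset of `S`. -/
structure IsLocalParam (S : Set E3) (U : Set E2) (φ : E2 → E3) : Prop where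
  isOpen : IsOpen U
  smooth : ContDiffOn ℝ ∞ φ U
  immersion : ∀ u ∈ U, Function.Injective (fderiv ℝ φ u)
  embedding : Topology.IsEmbedding (U.domRestrict φ)
  image : ∃ V : Set E3, IsOpen V ∧ φ '' U = S ∩ V

/-- `S` is a smooth (embedded) surface: each of its points lies in the image of a smooth local
parametrization. -/
def IsSmoothSurface (S : Set E3) : Prop :=
  ∀ p ∈ S, ∃ (U : Set E2) (φ : E2 → E3), IsLocalParam S U φ ∧ p ∈ φ '' U

/-- The tangent plane, at the point `φ u`, of the surface parametrized by `φ`. -/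
noncomputable def tangentPlane (φ : E2 → E3) (u : E2) : Submodule ℝ E3 :=
  LinearMap.range (fderiv ℝ φ u : E2 →ₗ[ℝ] E3)

/-- The second derivative `D²φ(u)(v, w)`. -/
noncomputable def secondDeriv (φ : E2 → E3) (u v w : E2) : E3 :=
  fderiv ℝ (fderiv ℝ φ) u v w

/-- The coordinate vectors of the parameter plane. -/
noncomputable def coordVec (i : Fin 2) : E2 := EuclideanSpace.single i 1

/-- The Euclidean unit normal of the surface parametrized by `φ`. -/
noncomputable def unitNormal (φ : E2 → E3) (u : E2) : E3 :=
  let n := cross3 (fderiv ℝ φ u (coordVec 0)) (fderiv ℝ φ u (coordVec 1))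
  (‖n‖)⁻¹ • n

/-- The matrix of the first fundamental form. -/
noncomputable def firstForm (φ : E2 → E3) (u : E2) : Matrix (Fin 2) (Fin 2) ℝ :=
  Matrix.of fun i j => inner ℝ (fderiv ℝ φ u (coordVec i)) (fderiv ℝ φ u (coordVec j))

/-- The matrix of the Euclidean second fundamental form. -/
noncomputable def secondForm (φ : E2 → E3) (u : E2) : Matrix (Fin 2) (Fin 2) ℝ :=
  Matrix.of fun i j => inner ℝ (secondDeriv φ u (coordVec i) (coordVec j)) (unitNormal φ u)

/-- The Euclidean Gaussian curvature, at the point `φ u`, of the surface parametrized by `φ`. -/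
noncomputable def gaussianCurvature (φ : E2 → E3) (u : E2) : ℝ :=
  (secondForm φ u).det / (firstForm φ u).det

/-! ### Admissible norms and the Birkhoff normal -/

/-- The unit sphere of `N`. -/
def unitSphere (N : Seminorm ℝ E3) : Set E3 := {x | N x = 1}

/-- `N` is an admissible norm on three-space: a norm whose unit sphere is a smooth surface of
strictly positive Euclidean Gaussian curvature. -/
structure IsAdmissibleNorm (N : Seminorm ℝ E3) : Prop where
  definite : ∀ x, N x = 0 → x = 0
  smooth : IsSmoothSurface (unitSphere N)
  curvature_pos : ∀ (U : Set E2) (φ : E2 → E3), IsLocalParam (unitSphere N) U φ →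
    ∀ u ∈ U, 0 < gaussianCurvature φ u

/-- `v` is Birkhoff orthogonal to the plane `P` with respect to `N`. -/
def BirkhoffOrthogonal (N : Seminorm ℝ E3) (v : E3) (P : Submodule ℝ E3) : Prop :=
  ∀ w ∈ P, ∀ t : ℝ, N v ≤ N (v + t • w)

/-- `η` (only its values on `S` matter) is a Birkhoff normal vector field, or Birkhoff-Gauss map, of
the surface `S`: it is continuous on `S`, and at each point it is a unit vector of `N` which is
Birkhoff orthogonal to the tangent plane. -/
structure IsBirkhoffNormalField (N : Seminorm ℝ E3) (S : Set E3) (η : E3 → E3) : Prop where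
  continuousOn : ContinuousOn η S
  unit : ∀ p ∈ S, N (η p) = 1
  orthogonal : ∀ (U : Set E2) (φ : E2 → E3), IsLocalParam S U φ → ∀ u ∈ U,
    BirkhoffOrthogonal N (η (φ u)) (tangentPlane φ u)

/-! ### The affine normal field -/

/-- `h` is the affine fundamental form at `φ u`, pulled back to the parameter plane, which the
transversal field `ζ` induces through the Gauss equation `D_X Y = ∇_X Y + h(X, Y) ζ`. -/
def IsAffineFundamentalForm (φ : E2 → E3) (ζ : E3 → E3) (u : E2)
    (h : LinearMap.BilinForm ℝ E2) : Prop :=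
  ∀ v w : E2, secondDeriv φ u v w - h v w • ζ (φ u) ∈ tangentPlane φ u

/-- `ζ` (only its values on `S` matter) is an affine normal field of the surface `S`, that is, an
equiaffine transversal vector field with which `S` is a Blaschke immersion. -/
structure IsAffineNormalField (S : Set E3) (ζ : E3 → E3) : Prop where
  smooth : ∀ (U : Set E2) (φ : E2 → E3), IsLocalParam S U φ → ContDiffOn ℝ ∞ (ζ ∘ φ) U
  transversal : ∀ (U : Set E2) (φ : E2 → E3), IsLocalParam S U φ → ∀ u ∈ U,
    ζ (φ u) ∉ tangentPlane φ u
  /-- the derivatives of `ζ` along `S` are tangential -/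
  equiaffine : ∀ (U : Set E2) (φ : E2 → E3), IsLocalParam S U φ → ∀ u ∈ U, ∀ v : E2,
    fderiv ℝ (ζ ∘ φ) u v ∈ tangentPlane φ u
  /-- `|ω| = ω_h`, where `ω(X, Y) = det[X, Y, ζ]` and `ω_h(X, Y) = |det [h_ij]|^(1/2)` -/
  volume : ∀ (U : Set E2) (φ : E2 → E3), IsLocalParam S U φ → ∀ u ∈ U,
    ∃ h : LinearMap.BilinForm ℝ E2, IsAffineFundamentalForm φ ζ u h ∧ ∀ v w : E2,
      |det3 (fderiv ℝ φ u v) (fderiv ℝ φ u w) (ζ (φ u))|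
        = √|(!![h v v, h v w; h w v, h w w]).det|

/-! ### Norms derived from an inner product -/

/-- `N` is the norm derived from the inner product `c`. -/
def IsNormOf (c : InnerProductSpace.Core ℝ E3) (N : Seminorm ℝ E3) : Prop :=
  ∀ x, N x = √(c.inner x x)

/-- The determinant of the Gram matrix of the standard basis for the inner product `c`. -/
noncomputable def gramDet (c : InnerProductSpace.Core ℝ E3) : ℝ :=
  (Matrix.of fun i j : Fin 3 =>
    c.inner (EuclideanSpace.single i 1) (EuclideanSpace.single j 1)).det

/-!
The energy `G = N² / 2` of an admissible norm is smooth off the origin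
(`IsAdmissibleNorm.smoothOffZero_energy`) and homogeneous of degree two, and the tangent plane of
the unit sphere at `p` is the kernel of `dG(p)` (`mem_tangentPlane_iff`). The Hessian of `G` is
positive semidefinite because `dG` is monotone. Restricted to a tangent plane it is a multiple of
the second fundamental form, so positive curvature makes it definite (`posDef_hessMatrix_energy`).

A Birkhoff normal at `p` is a unit vector `q` whose differential `dG(q)` is proportional to
`dG(p)`. Strict convexity gives `q = ± p`, and connectedness of the sphere makes the sign constant
(`IsBirkhoffNormalField.eq_id_or_eq_neg`). The question is therefore when `s p`, for a constant
`s ≠ 0`, is an affine normal field. Such a field is always transversal and equiaffine, and its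
affine fundamental form is `-s⁻¹ D²G`. Since `p` is `D²G`-orthogonal to the tangent plane with
`D²G(p, p) = 1`, the volume condition says precisely that `det D²G = s⁴`
(`isAffineNormalField_iff_det`).

It remains to see that a constant Hessian determinant forces `D²G` itself to be constant, which is
Deicke's theorem (`matDeriv_hessMatrix_eq_zero`). Write `g = D²G` and let `u = g_mm` be a diagonal
entry. Differentiating `log det g = const` once shows that the columns of `g⁻¹` are divergence
free, and differentiating it twice in the direction `m` gives
`div (g⁻¹ ∇u) = tr (g⁻¹ ∂_m g g⁻¹ ∂_m g) ≥ 0`. On the other hand `u` is homogeneous of degree zero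
and `g x = ∇G`, so `⟨∇G, g⁻¹ ∇u⟩ = ⟨x, ∇u⟩ = 0`: the field `g⁻¹ ∇u` is tangential to the level
sets of `G`. By the divergence theorem, with a cut-off depending on `G` only, the nonnegative
trace has integral zero, hence `∂_m g = 0`. A constant `D²G` is the inner product from which `N`
is derived, and its Gram determinant is `det D²G`.
-/

/-! ### Partial derivatives off the origin -/

/-- The partial derivative of `f` in the direction of the `i`-th standard basis vector. -/
noncomputable def partialDeriv (i : Fin 3) (f : E3 → ℝ) (x : E3) : ℝ :=
  fderiv ℝ f x (EuclideanSpace.single i 1)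

/-- `f` is smooth on the complement of the origin. -/
def SmoothOffZero (f : E3 → ℝ) : Prop := ∀ x, x ≠ 0 → ContDiffAt ℝ ∞ f x

namespace SmoothOffZero

variable {f g : E3 → ℝ}

lemma differentiableAt (hf : SmoothOffZero f) {x : E3} (hx : x ≠ 0) : DifferentiableAt ℝ f x :=
  (hf x hx).differentiableAt (by simp)

lemma partialDeriv (hf : SmoothOffZero f) (i : Fin 3) : SmoothOffZero (partialDeriv i f) :=
  fun x hx => ((hf x hx).fderiv_right (m := ∞) (by simp)).clm_apply contDiffAt_const

lemma const (c : ℝ) : SmoothOffZero fun _ => c := fun _ _ => contDiffAt_const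

lemma sub (hf : SmoothOffZero f) (hg : SmoothOffZero g) : SmoothOffZero fun x => f x - g x :=
  fun x hx => (hf x hx).sub (hg x hx)

lemma mul (hf : SmoothOffZero f) (hg : SmoothOffZero g) : SmoothOffZero fun x => f x * g x :=
  fun x hx => (hf x hx).mul (hg x hx)

lemma sum {f : Fin 3 → E3 → ℝ} (hf : ∀ i, SmoothOffZero (f i)) :
    SmoothOffZero fun x => ∑ i, f i x :=
  fun x hx => ContDiffAt.sum fun i _ => hf i x hx

end SmoothOffZero

lemma partialDeriv_const (i : Fin 3) (c : ℝ) (x : E3) : partialDeriv i (fun _ => c) x = 0 := by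
  simp [partialDeriv]

lemma partialDeriv_mul {f g : E3 → ℝ} {x : E3} (i : Fin 3) (hf : DifferentiableAt ℝ f x)
    (hg : DifferentiableAt ℝ g x) :
    partialDeriv i (fun y => f y * g y) x
      = partialDeriv i f x * g x + f x * partialDeriv i g x := by
  simp only [partialDeriv, fderiv_fun_mul hf hg]
  simp; ring

lemma partialDeriv_add {f g : E3 → ℝ} {x : E3} (i : Fin 3) (hf : DifferentiableAt ℝ f x)
    (hg : DifferentiableAt ℝ g x) :
    partialDeriv i (fun y => f y + g y) x = partialDeriv i f x + partialDeriv i g x := by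
  simp only [partialDeriv, fderiv_fun_add hf hg]
  simp

lemma partialDeriv_sub {f g : E3 → ℝ} {x : E3} (i : Fin 3) (hf : DifferentiableAt ℝ f x)
    (hg : DifferentiableAt ℝ g x) :
    partialDeriv i (fun y => f y - g y) x = partialDeriv i f x - partialDeriv i g x := by
  simp only [partialDeriv, fderiv_fun_sub hf hg]
  simp

lemma partialDeriv_sum {f : Fin 3 → E3 → ℝ} {x : E3} (i : Fin 3)
    (hf : ∀ j, DifferentiableAt ℝ (f j) x) :
    partialDeriv i (fun y => ∑ j, f j y) x = ∑ j, partialDeriv i (f j) x := by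
  simp only [partialDeriv]
  rw [fderiv_fun_sum fun j _ => hf j]
  simp

lemma partialDeriv_congr {f g : E3 → ℝ} (h : ∀ x, x ≠ 0 → f x = g x) (i : Fin 3) {x : E3}
    (hx : x ≠ 0) : partialDeriv i f x = partialDeriv i g x := by
  have : f =ᶠ[nhds x] g := by
    filter_upwards [isOpen_compl_singleton.mem_nhds hx] with y hy using h y hy
  simp [partialDeriv, this.fderiv_eq]

/-- The partial derivatives are the entries of the iterated Fréchet derivative. -/
lemma partialDeriv_partialDeriv {f : E3 → ℝ} (hf : SmoothOffZero f) (i j : Fin 3) {x : E3}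
    (hx : x ≠ 0) : partialDeriv i (partialDeriv j f) x
      = fderiv ℝ (fderiv ℝ f) x (EuclideanSpace.single i 1) (EuclideanSpace.single j 1) := by
  have h : DifferentiableAt ℝ (fderiv ℝ f) x :=
    ((hf x hx).fderiv_right (m := ∞) (by simp)).differentiableAt (by simp)
  unfold partialDeriv
  rw [fderiv_clm_apply h (differentiableAt_const _)]
  simp

lemma fderiv_fderiv_symm {f : E3 → ℝ} (hf : SmoothOffZero f) {x : E3} (hx : x ≠ 0) (v w : E3) :
    fderiv ℝ (fderiv ℝ f) x v w = fderiv ℝ (fderiv ℝ f) x w v :=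
  ((hf x hx).isSymmSndFDerivAt (by simpa using ENat.LEInfty.out)).eq v w

lemma partialDeriv_comm {f : E3 → ℝ} (hf : SmoothOffZero f) (i j : Fin 3) {x : E3}
    (hx : x ≠ 0) : partialDeriv i (partialDeriv j f) x = partialDeriv j (partialDeriv i f) x := by
  rw [partialDeriv_partialDeriv hf i j hx, partialDeriv_partialDeriv hf j i hx,
    fderiv_fderiv_symm hf hx]

lemma E3.sum_smul_single (x : E3) : ∑ i, x i • (EuclideanSpace.single i (1 : ℝ) : E3) = x := by
  ext j
  simp [Finset.sum_apply, Pi.single_apply]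

lemma sum_mul_partialDeriv (f : E3 → ℝ) (x v : E3) :
    ∑ i, v i * partialDeriv i f x = fderiv ℝ f x v := by
  conv_rhs => rw [← E3.sum_smul_single v]
  simp [partialDeriv]

/-! ### Matrix-valued functions -/

/-- The entrywise partial derivative of a matrix-valued function. -/
noncomputable def matDeriv (k : Fin 3) (A : E3 → Matrix (Fin 3) (Fin 3) ℝ) (x : E3) :
    Matrix (Fin 3) (Fin 3) ℝ :=
  Matrix.of fun i j => partialDeriv k (fun y => A y i j) x

/-- All entries of the matrix-valued function `A` are smooth off the origin. -/
def MatSmooth (A : E3 → Matrix (Fin 3) (Fin 3) ℝ) : Prop :=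
  ∀ i j, SmoothOffZero fun x => A x i j

lemma MatSmooth.matDeriv {A : E3 → Matrix (Fin 3) (Fin 3) ℝ} (hA : MatSmooth A) (k : Fin 3) :
    MatSmooth (matDeriv k A) := fun i j => (hA i j).partialDeriv k

lemma MatSmooth.mul {A B : E3 → Matrix (Fin 3) (Fin 3) ℝ} (hA : MatSmooth A) (hB : MatSmooth B) :
    MatSmooth fun x => A x * B x := fun i j => by
  simpa only [Matrix.mul_apply] using SmoothOffZero.sum fun l => (hA i l).mul (hB l j)

lemma matDeriv_mul {A B : E3 → Matrix (Fin 3) (Fin 3) ℝ} (hA : MatSmooth A) (hB : MatSmooth B)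
    (k : Fin 3) {x : E3} (hx : x ≠ 0) :
    matDeriv k (fun y => A y * B y) x = matDeriv k A x * B x + A x * matDeriv k B x := by
  ext i j
  simp only [matDeriv, Matrix.of_apply, Matrix.add_apply, Matrix.mul_apply]
  rw [partialDeriv_sum _ fun l => ((hA i l).mul (hB l j)).differentiableAt hx,
    ← Finset.sum_add_distrib]
  refine Finset.sum_congr rfl fun l _ => ?_
  exact partialDeriv_mul k ((hA i l).differentiableAt hx) ((hB l j).differentiableAt hx)

lemma partialDeriv_trace {A : E3 → Matrix (Fin 3) (Fin 3) ℝ} (hA : MatSmooth A)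
    (k : Fin 3) {x : E3} (hx : x ≠ 0) :
    partialDeriv k (fun y => (A y).trace) x = (matDeriv k A x).trace := by
  simp only [Matrix.trace, matDeriv, Matrix.diag, Matrix.of_apply]
  exact partialDeriv_sum _ fun l => (hA l l).differentiableAt hx

lemma MatSmooth.adjugate {A : E3 → Matrix (Fin 3) (Fin 3) ℝ} (hA : MatSmooth A) :
    MatSmooth fun x => (A x).adjugate := by
  intro i j
  simp only [Matrix.adjugate_fin_three]
  fin_cases i <;> fin_cases j <;>
    simp [neg_add_eq_sub] <;>
    exact ((hA _ _).mul (hA _ _)).sub ((hA _ _).mul (hA _ _))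

/-- Jacobi's formula for the derivative of a determinant. -/
lemma partialDeriv_det {A : E3 → Matrix (Fin 3) (Fin 3) ℝ} (hA : MatSmooth A)
    (k : Fin 3) {x : E3} (hx : x ≠ 0) :
    partialDeriv k (fun y => (A y).det) x = ((A x).adjugate * matDeriv k A x).trace := by
  have h := fun i j => (hA i j).differentiableAt hx
  have h2 := fun i j i' j' => ((hA i j).mul (hA i' j')).differentiableAt hx
  simp only [Matrix.det_fin_three]
  rw [partialDeriv_sub, partialDeriv_add, partialDeriv_add, partialDeriv_sub, partialDeriv_sub]
  · have hd : ∀ i j, partialDeriv k (fun y => A y i j) x = matDeriv k A x i j := fun _ _ => rfl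
    simp only [partialDeriv_mul k (h2 _ _ _ _) (h _ _), partialDeriv_mul k (h _ _) (h _ _), hd]
    simp only [Matrix.adjugate_fin_three, Matrix.trace_fin_three, Matrix.mul_apply,
      Fin.sum_univ_three, Matrix.of_apply, Matrix.cons_val]
    ring
  all_goals fun_prop (disch := assumption)

/-- For a positive definite `M`, the form `A ↦ tr (M A M A)` is positive definite on symmetric
matrices: it is the squared Frobenius norm of `B A Bᵀ`, where `M = Bᵀ B`. -/
lemma Matrix.PosDef.trace_mul_mul_mul {M A : Matrix (Fin 3) (Fin 3) ℝ} (hM : M.PosDef)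
    (hA : A.IsSymm) : 0 ≤ (M * A * M * A).trace ∧ ((M * A * M * A).trace = 0 → A = 0) := by
  obtain ⟨B, hB⟩ : ∃ B : Matrix (Fin 3) (Fin 3) ℝ, M = B.conjTranspose * B := by
    open scoped MatrixOrder in
    exact CStarAlgebra.nonneg_iff_eq_star_mul_self.mp hM.posSemidef.nonneg
  rw [Matrix.conjTranspose_eq_transpose_of_trivial] at hB
  have hBdet : IsUnit B.det := by
    have := hM.det_pos
    rw [hB, Matrix.det_mul, Matrix.det_transpose] at this
    exact isUnit_iff_ne_zero.mpr fun h => by simp [h] at this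
  have key : (M * A * M * A).trace
      = ((B * A * B.transpose).conjTranspose * (B * A * B.transpose)).trace := by
    rw [hB, Matrix.conjTranspose_eq_transpose_of_trivial, Matrix.transpose_mul,
      Matrix.transpose_mul, Matrix.transpose_transpose, hA.eq]
    calc (B.transpose * B * A * (B.transpose * B) * A).trace
        = (B.transpose * (B * A * (B.transpose * B) * A)).trace := by simp only [Matrix.mul_assoc]
      _ = ((B * A * (B.transpose * B) * A) * B.transpose).trace := Matrix.trace_mul_comm _ _
      _ = _ := by simp only [Matrix.mul_assoc]
  rw [key]
  refine ⟨(Matrix.posSemidef_conjTranspose_mul_self _).trace_nonneg, fun h => ?_⟩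
  have h0 := Matrix.trace_conjTranspose_mul_self_eq_zero_iff.mp h
  have hBt : IsUnit B.transpose.det := by rwa [Matrix.det_transpose]
  calc A = B⁻¹ * (B * A * B.transpose) * B.transpose⁻¹ := by
        rw [Matrix.mul_assoc B A, Matrix.nonsing_inv_mul_cancel_left _ _ hBdet,
          Matrix.mul_nonsing_inv_cancel_right _ _ hBt]
    _ = 0 := by rw [h0]; simp

/-! ### Deicke's theorem -/

/-- The Hessian matrix of `f` in the standard basis. -/
noncomputable def hessMatrix (f : E3 → ℝ) (x : E3) : Matrix (Fin 3) (Fin 3) ℝ :=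
  Matrix.of fun i j => partialDeriv i (partialDeriv j f) x

lemma hessMatrix_apply (f : E3 → ℝ) (x : E3) (i j : Fin 3) :
    hessMatrix f x i j = partialDeriv i (partialDeriv j f) x := rfl

lemma matSmooth_hessMatrix {f : E3 → ℝ} (hf : SmoothOffZero f) : MatSmooth (hessMatrix f) :=
  fun i j => (hf.partialDeriv j).partialDeriv i

lemma hessMatrix_isSymm {f : E3 → ℝ} (hf : SmoothOffZero f) {x : E3} (hx : x ≠ 0) :
    (hessMatrix f x).IsSymm := by
  ext i j
  exact partialDeriv_comm hf j i hx

/-- The third derivatives of `f` are symmetric: the index of the outer derivative may be exchanged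
with the first index of the Hessian. -/
lemma matDeriv_hessMatrix_swap {f : E3 → ℝ} (hf : SmoothOffZero f) {x : E3} (hx : x ≠ 0)
    (k i j : Fin 3) :
    matDeriv k (hessMatrix f) x i j = matDeriv i (hessMatrix f) x k j :=
  partialDeriv_comm (hf.partialDeriv j) k i hx

lemma matDeriv_hessMatrix_isSymm {f : E3 → ℝ} (hf : SmoothOffZero f) {x : E3} (hx : x ≠ 0)
    (k : Fin 3) : (matDeriv k (hessMatrix f) x).IsSymm := by
  ext i j
  exact partialDeriv_congr (fun y hy => partialDeriv_comm hf j i hy) k hx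

lemma fderiv_apply_self_of_homogeneous {f : E3 → ℝ} {n : ℕ} {x : E3} (hf : DifferentiableAt ℝ f x)
    (hom : ∀ t : ℝ, 0 < t → f (t • x) = t ^ n * f x) : fderiv ℝ f x x = n * f x := by
  have h1 : HasDerivAt (fun t : ℝ => f (t • x)) (fderiv ℝ f x x) 1 := by
    have h : HasDerivAt (fun t : ℝ => t • x) x 1 := by
      simpa using (hasDerivAt_id (1 : ℝ)).smul_const x
    have hf' : HasFDerivAt f (fderiv ℝ f x) ((1 : ℝ) • x) := by simpa using hf.hasFDerivAt
    exact hf'.comp_hasDerivAt (1 : ℝ) h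
  have h2 : HasDerivAt (fun t : ℝ => t ^ n * f x) (n * f x) 1 := by
    simpa using (hasDerivAt_pow n (1 : ℝ)).mul_const (f x)
  refine h1.unique (h2.congr_of_eventuallyEq ?_)
  filter_upwards [lt_mem_nhds one_pos] with t ht using hom t ht

/-- The differential of a 2-homogeneous function is homogeneous of degree one. -/
lemma fderiv_smul_of_homogeneous {f : E3 → ℝ} (hf : SmoothOffZero f)
    (hom : ∀ t : ℝ, 0 < t → ∀ x, f (t • x) = t ^ 2 * f x) {t : ℝ} (ht : 0 < t) {x : E3}
    (hx : x ≠ 0) : fderiv ℝ f (t • x) = t • fderiv ℝ f x := by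
  have htx : t • x ≠ 0 := smul_ne_zero ht.ne' hx
  have h1 : HasFDerivAt (fun y => f (t • y))
      ((fderiv ℝ f (t • x)).comp (t • ContinuousLinearMap.id ℝ E3)) x :=
    (hf.differentiableAt htx).hasFDerivAt.comp x ((hasFDerivAt_id x).const_smul t)
  have h2 : HasFDerivAt (fun y => f (t • y)) (t ^ 2 • fderiv ℝ f x) x := by
    have := (hf.differentiableAt hx).hasFDerivAt.const_mul (t ^ 2)
    exact this.congr_of_eventuallyEq (Filter.Eventually.of_forall fun y => hom t ht y)
  have h := h1.unique h2
  ext v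
  have hv := congrArg (fun L : E3 →L[ℝ] ℝ => L v) h
  simp only [ContinuousLinearMap.comp_apply, smul_apply,
    ContinuousLinearMap.id_apply, map_smul, smul_eq_mul] at hv ⊢
  have : t * (fderiv ℝ f (t • x) v - t * fderiv ℝ f x v) = 0 := by linarith
  rcases mul_eq_zero.mp this with h | h
  · exact absurd h ht.ne'
  · linarith

/-- The second differential of a 2-homogeneous function is homogeneous of degree zero. -/
lemma fderiv_fderiv_smul_of_homogeneous {f : E3 → ℝ} (hf : SmoothOffZero f)
    (hom : ∀ t : ℝ, 0 < t → ∀ x, f (t • x) = t ^ 2 * f x) {t : ℝ} (ht : 0 < t) {x : E3}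
    (hx : x ≠ 0) : fderiv ℝ (fderiv ℝ f) (t • x) = fderiv ℝ (fderiv ℝ f) x := by
  have htx : t • x ≠ 0 := smul_ne_zero ht.ne' hx
  have hd : ∀ y, y ≠ 0 → DifferentiableAt ℝ (fderiv ℝ f) y := fun y hy =>
    ((hf y hy).fderiv_right (m := ∞) (by simp)).differentiableAt (by simp)
  have h1 : HasFDerivAt (fun y => fderiv ℝ f (t • y))
      ((fderiv ℝ (fderiv ℝ f) (t • x)).comp (t • ContinuousLinearMap.id ℝ E3)) x :=
    (hd _ htx).hasFDerivAt.comp x ((hasFDerivAt_id x).const_smul t)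
  have h2 : HasFDerivAt (fun y => fderiv ℝ f (t • y)) (t • fderiv ℝ (fderiv ℝ f) x) x := by
    refine ((hd x hx).hasFDerivAt.const_smul t).congr_of_eventuallyEq ?_
    filter_upwards [isOpen_compl_singleton.mem_nhds hx] with y hy
      using fderiv_smul_of_homogeneous hf hom ht hy
  have h := h1.unique h2
  ext v w
  have hv := congrArg (fun L : E3 →L[ℝ] E3 →L[ℝ] ℝ => L v w) h
  simp only [ContinuousLinearMap.comp_apply, smul_apply,
    ContinuousLinearMap.id_apply, map_smul, smul_eq_mul] at hv
  exact mul_left_cancel₀ ht.ne' hv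

/-- Euler's identity for the differential of a 2-homogeneous function. -/
lemma fderiv_fderiv_apply_self {f : E3 → ℝ} (hf : SmoothOffZero f)
    (hom : ∀ t : ℝ, 0 < t → ∀ x, f (t • x) = t ^ 2 * f x) {x : E3} (hx : x ≠ 0) (w : E3) :
    fderiv ℝ (fderiv ℝ f) x w x = fderiv ℝ f x w := by
  have hd : DifferentiableAt ℝ (fderiv ℝ f) x :=
    ((hf x hx).fderiv_right (m := ∞) (by simp)).differentiableAt (by simp)
  have h := fderiv_apply_self_of_homogeneous (f := fun y => fderiv ℝ f y w) (n := 1) (x := x)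
    (hd.clm_apply (differentiableAt_const w)) fun t ht => by
      simp [fderiv_smul_of_homogeneous hf hom ht hx]
  rw [fderiv_clm_apply hd (differentiableAt_const _)] at h
  rw [fderiv_fderiv_symm hf hx]
  simpa using h

lemma integral_partialDeriv_eq_zero {f : E3 → ℝ} (hf : ContDiff ℝ 1 f) (hc : HasCompactSupport f)
    (i : Fin 3) : ∫ x, partialDeriv i f x = 0 := by
  have hint : MeasureTheory.Integrable fun x => partialDeriv i f x := by
    refine Continuous.integrable_of_hasCompactSupport ?_ ?_
    · exact (hf.continuous_fderiv (by simp)).clm_apply continuous_const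
    · exact hc.fderiv_apply (𝕜 := ℝ) (v := (EuclideanSpace.single i 1 : E3))
  have := integral_mul_fderiv_eq_neg_fderiv_mul_of_integrable (μ := MeasureTheory.volume)
    (f := f) (g := fun _ : E3 => (1 : ℝ)) (v := (EuclideanSpace.single i 1 : E3))
    (by simpa [partialDeriv] using hint) (by simp)
    (by simpa using hf.continuous.integrable_of_hasCompactSupport hc)
    (fun x _ => hf.differentiable (by simp) x) (fun x _ => by fun_prop)
  simpa [partialDeriv] using this

section Deicke

variable {G : E3 → ℝ} {K : ℝ}

/-- The inverse Hessian matrix, for a function whose Hessian determinant is the constant `K`; it is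
written as a multiple of the adjugate, whose entries are visibly smooth. -/
noncomputable def hessInv (G : E3 → ℝ) (K : ℝ) (x : E3) : Matrix (Fin 3) (Fin 3) ℝ :=
  K⁻¹ • (hessMatrix G x).adjugate

lemma matSmooth_hessInv (hG : SmoothOffZero G) : MatSmooth (hessInv G K) := fun i j =>
  (SmoothOffZero.const K⁻¹).mul ((matSmooth_hessMatrix hG).adjugate i j)

lemma hessInv_mul_hessMatrix (hK : K ≠ 0) {x : E3} (hdet : (hessMatrix G x).det = K) :
    hessInv G K x * hessMatrix G x = 1 := by
  rw [hessInv, Matrix.smul_mul, Matrix.adjugate_mul, hdet, smul_smul, inv_mul_cancel₀ hK, one_smul]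

lemma hessMatrix_mul_hessInv (hK : K ≠ 0) {x : E3} (hdet : (hessMatrix G x).det = K) :
    hessMatrix G x * hessInv G K x = 1 := by
  rw [hessInv, Matrix.mul_smul, Matrix.mul_adjugate, hdet, smul_smul, inv_mul_cancel₀ hK, one_smul]

/-- The vanishing of the mean Cartan tensor `g^{ij} G_{ijk}`. -/
lemma trace_hessInv_mul_matDeriv (hG : SmoothOffZero G)
    (hdet : ∀ x, x ≠ 0 → (hessMatrix G x).det = K) (k : Fin 3) {x : E3} (hx : x ≠ 0) :
    (hessInv G K x * matDeriv k (hessMatrix G) x).trace = 0 := by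
  have h := partialDeriv_det (matSmooth_hessMatrix hG) k hx
  rw [partialDeriv_congr hdet k hx, partialDeriv_const] at h
  rw [hessInv, Matrix.smul_mul, Matrix.trace_smul, ← h, smul_zero]

lemma matDeriv_hessInv (hG : SmoothOffZero G) (hK : K ≠ 0)
    (hdet : ∀ x, x ≠ 0 → (hessMatrix G x).det = K) (k : Fin 3) {x : E3} (hx : x ≠ 0) :
    matDeriv k (hessInv G K) x
      = -(hessInv G K x * matDeriv k (hessMatrix G) x * hessInv G K x) := by
  have h := matDeriv_mul (matSmooth_hessInv (K := K) hG) (matSmooth_hessMatrix hG) k hx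
  have h0 : matDeriv k (fun y => hessInv G K y * hessMatrix G y) x = 0 := by
    ext i j
    have := partialDeriv_congr (f := fun y => (hessInv G K y * hessMatrix G y) i j)
      (g := fun _ => (1 : Matrix (Fin 3) (Fin 3) ℝ) i j)
      (fun y hy => by rw [hessInv_mul_hessMatrix hK (hdet y hy)]) k hx
    simpa [matDeriv, partialDeriv_const] using this
  rw [h0] at h
  have h2 := congrArg (· * hessInv G K x) h
  simp only [Matrix.zero_mul, Matrix.add_mul] at h2
  rw [Matrix.mul_assoc (matDeriv k _ x), hessMatrix_mul_hessInv hK (hdet x hx), Matrix.mul_one]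
    at h2
  exact eq_neg_of_add_eq_zero_left h2.symm

/-- The vanishing of the second derivative of `log det` of the Hessian. -/
lemma trace_hessInv_mul_matDeriv_matDeriv (hG : SmoothOffZero G) (hK : K ≠ 0)
    (hdet : ∀ x, x ≠ 0 → (hessMatrix G x).det = K) (k : Fin 3) {x : E3} (hx : x ≠ 0) :
    (hessInv G K x * matDeriv k (matDeriv k (hessMatrix G)) x).trace
      = (hessInv G K x * matDeriv k (hessMatrix G) x * hessInv G K x
          * matDeriv k (hessMatrix G) x).trace := by
  have hM := matSmooth_hessInv (K := K) hG
  have hD := (matSmooth_hessMatrix hG).matDeriv k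
  have h := partialDeriv_trace (hM.mul hD) k hx
  rw [partialDeriv_congr (fun y hy => trace_hessInv_mul_matDeriv hG hdet k hy) k hx,
    partialDeriv_const, matDeriv_mul hM hD k hx, matDeriv_hessInv hG hK hdet k hx,
    Matrix.neg_mul, Matrix.trace_add, Matrix.trace_neg] at h
  linarith

/-- The columns of the inverse Hessian are divergence free. -/
lemma sum_matDeriv_hessInv (hG : SmoothOffZero G) (hK : K ≠ 0)
    (hdet : ∀ x, x ≠ 0 → (hessMatrix G x).det = K) (j : Fin 3) {x : E3} (hx : x ≠ 0) :
    ∑ i, matDeriv i (hessInv G K) x i j = 0 := by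
  have key : ∀ b, ∑ i, ∑ a, hessInv G K x i a * matDeriv i (hessMatrix G) x a b = 0 := by
    intro b
    have h := trace_hessInv_mul_matDeriv hG hdet b hx
    simp only [Matrix.trace, Matrix.diag, Matrix.mul_apply] at h
    rw [← h]
    refine Finset.sum_congr rfl fun i _ => Finset.sum_congr rfl fun a _ => ?_
    rw [← (matDeriv_hessMatrix_isSymm hG hx i).apply, matDeriv_hessMatrix_swap hG hx i b a,
      ← (matDeriv_hessMatrix_isSymm hG hx b).apply]
  simp only [matDeriv_hessInv hG hK hdet _ hx, Matrix.neg_apply, Finset.sum_neg_distrib,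
    neg_eq_zero]
  calc ∑ i, (hessInv G K x * matDeriv i (hessMatrix G) x * hessInv G K x) i j
      = ∑ b, (∑ i, ∑ a, hessInv G K x i a * matDeriv i (hessMatrix G) x a b)
          * hessInv G K x b j := by
        simp only [Matrix.mul_apply, Finset.sum_mul]
        rw [Finset.sum_comm]
    _ = 0 := by simp [key]

/-- The gradient of `G_mm` with respect to the Hessian metric of `G`. -/
noncomputable def hessGrad (G : E3 → ℝ) (K : ℝ) (m i : Fin 3) (x : E3) : ℝ :=
  ∑ j, hessInv G K x i j * partialDeriv j (fun y => hessMatrix G y m m) x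

lemma smoothOffZero_hessGrad (hG : SmoothOffZero G) (m i : Fin 3) :
    SmoothOffZero (hessGrad G K m i) :=
  SmoothOffZero.sum fun j =>
    (matSmooth_hessInv hG i j).mul ((matSmooth_hessMatrix hG m m).partialDeriv j)

/-- The fourth derivatives of `G` are symmetric. -/
lemma partialDeriv_partialDeriv_hessMatrix (hG : SmoothOffZero G) (m i j : Fin 3) {x : E3}
    (hx : x ≠ 0) : partialDeriv i (partialDeriv j fun y => hessMatrix G y m m) x
      = matDeriv m (matDeriv m (hessMatrix G)) x j i := by
  have h1 : ∀ y, y ≠ 0 → partialDeriv j (fun z => hessMatrix G z m m) y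
      = partialDeriv m (fun z => hessMatrix G z m j) y := fun y hy =>
    (matDeriv_hessMatrix_swap hG hy j m m).trans
      ((matDeriv_hessMatrix_isSymm hG hy m).apply m j)
  rw [partialDeriv_congr h1 i hx, partialDeriv_comm (matSmooth_hessMatrix hG m j) i m hx]
  refine partialDeriv_congr (fun y hy => ?_) m hx
  have h2 := matDeriv_hessMatrix_swap hG hy i m j
  exact h2.trans ((matDeriv_hessMatrix_isSymm hG hy m).apply j i)

lemma sum_partialDeriv_hessGrad (hG : SmoothOffZero G) (hK : K ≠ 0)
    (hdet : ∀ x, x ≠ 0 → (hessMatrix G x).det = K) (m : Fin 3) {x : E3} (hx : x ≠ 0) :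
    ∑ i, partialDeriv i (hessGrad G K m i) x
      = (hessInv G K x * matDeriv m (hessMatrix G) x * hessInv G K x
          * matDeriv m (hessMatrix G) x).trace := by
  rw [← trace_hessInv_mul_matDeriv_matDeriv hG hK hdet m hx]
  have hM := matSmooth_hessInv (K := K) hG
  have hu := matSmooth_hessMatrix hG m m
  have h1 : ∀ i, partialDeriv i (hessGrad G K m i) x
      = ∑ j, (matDeriv i (hessInv G K) x i j * partialDeriv j (fun y => hessMatrix G y m m) x
        + hessInv G K x i j * matDeriv m (matDeriv m (hessMatrix G)) x j i) := by
    intro i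
    refine (partialDeriv_sum i fun j =>
      ((hM i j).mul (hu.partialDeriv j)).differentiableAt hx).trans ?_
    refine Finset.sum_congr rfl fun j _ => ?_
    rw [← partialDeriv_partialDeriv_hessMatrix hG m i j hx]
    exact partialDeriv_mul i ((hM i j).differentiableAt hx)
      ((hu.partialDeriv j).differentiableAt hx)
  simp only [h1, Finset.sum_add_distrib, Matrix.trace, Matrix.diag, Matrix.mul_apply]
  rw [Finset.sum_comm]
  simp [← Finset.sum_mul, sum_matDeriv_hessInv hG hK hdet _ hx]

/-- The gradient of `G_mm` is tangential to the level sets of `G`, since `G_mm` is homogeneous of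
degree zero and the radial vector is the gradient of `G` with respect to the Hessian metric. -/
lemma sum_partialDeriv_mul_hessGrad (hG : SmoothOffZero G) (hK : K ≠ 0)
    (hom : ∀ t : ℝ, 0 < t → ∀ x, G (t • x) = t ^ 2 * G x)
    (hdet : ∀ x, x ≠ 0 → (hessMatrix G x).det = K) (m : Fin 3) {x : E3} (hx : x ≠ 0) :
    ∑ i, partialDeriv i G x * hessGrad G K m i x = 0 := by
  have hgrad : ∀ i, partialDeriv i G x = ∑ a, x a * hessMatrix G x a i := by
    intro i
    have h := fderiv_fderiv_apply_self hG hom hx (EuclideanSpace.single i 1)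
    rw [partialDeriv, ← h, fderiv_fderiv_symm hG hx]
    conv_lhs => enter [1, 2]; rw [← E3.sum_smul_single x]
    simp [hessMatrix_apply, partialDeriv_partialDeriv hG _ _ hx]
  have hinv : ∀ a j, ∑ i, hessMatrix G x a i * hessInv G K x i j
      = (1 : Matrix (Fin 3) (Fin 3) ℝ) a j := fun a j => by
    rw [← hessMatrix_mul_hessInv hK (hdet x hx), Matrix.mul_apply]
  have hrad : ∑ j, x j * partialDeriv j (fun y => hessMatrix G y m m) x = 0 := by
    rw [sum_mul_partialDeriv,
      fderiv_apply_self_of_homogeneous (n := 0) ((matSmooth_hessMatrix hG m m).differentiableAt hx)]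
    · simp
    · intro t ht
      simp only [hessMatrix_apply, partialDeriv_partialDeriv hG _ _ hx,
        partialDeriv_partialDeriv hG _ _ (smul_ne_zero ht.ne' hx),
        fderiv_fderiv_smul_of_homogeneous hG hom ht hx]
      simp
  calc ∑ i, partialDeriv i G x * hessGrad G K m i x
      = ∑ j, (∑ a, x a * ∑ i, hessMatrix G x a i * hessInv G K x i j)
          * partialDeriv j (fun y => hessMatrix G y m m) x := by
        simp only [hgrad, hessGrad, Fin.sum_univ_three]
        ring
    _ = ∑ j, x j * partialDeriv j (fun y => hessMatrix G y m m) x := by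
        simp [hinv, Matrix.one_apply]
    _ = 0 := hrad

/-- **Deicke's theorem**: a 2-homogeneous function with positive definite Hessian of constant
determinant has vanishing third derivatives. -/
theorem matDeriv_hessMatrix_eq_zero (hG : SmoothOffZero G) (hcont : Continuous G)
    (hcoer : Filter.Tendsto G (Filter.cocompact E3) Filter.atTop)
    (hpos : ∀ x, x ≠ 0 → 0 < G x)
    (hom : ∀ t : ℝ, 0 < t → ∀ x, G (t • x) = t ^ 2 * G x)
    (hPD : ∀ x, x ≠ 0 → (hessMatrix G x).PosDef)
    (hK : K ≠ 0) (hdet : ∀ x, x ≠ 0 → (hessMatrix G x).det = K) (m : Fin 3) {x₀ : E3}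
    (hx₀ : x₀ ≠ 0) : matDeriv m (hessMatrix G) x₀ = 0 := by
  have hG0 : G 0 = 0 := by
    have := hom 2 (by norm_num) 0
    rw [smul_zero] at this
    linarith
  have hMPD : ∀ x, x ≠ 0 → (hessInv G K x).PosDef := fun x hx => by
    have : hessInv G K x = (hessMatrix G x)⁻¹ :=
      (Matrix.inv_eq_left_inv (hessInv_mul_hessMatrix hK (hdet x hx))).symm
    rw [this]
    exact (hPD x hx).inv
  -- the integrand, before the cut-off
  let q : E3 → ℝ := fun x => (hessInv G K x * matDeriv m (hessMatrix G) x * hessInv G K x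
    * matDeriv m (hessMatrix G) x).trace
  have hq : ∀ x, x ≠ 0 → 0 ≤ q x ∧ (q x = 0 → matDeriv m (hessMatrix G) x = 0) := fun x hx =>
    (hMPD x hx).trace_mul_mul_mul (matDeriv_hessMatrix_isSymm hG hx m)
  have hqs : SmoothOffZero q := by
    have hA := ((matSmooth_hessInv (K := K) hG).mul ((matSmooth_hessMatrix hG).matDeriv m))
    have := (hA.mul (matSmooth_hessInv (K := K) hG)).mul ((matSmooth_hessMatrix hG).matDeriv m)
    exact SmoothOffZero.sum fun i => this i i
  -- a cut-off function of the value of `G`, which vanishes near the origin and near infinity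
  have hc : 0 < G x₀ := hpos x₀ hx₀
  let ψ : ContDiffBump (G x₀) := ⟨G x₀ / 4, G x₀ / 2, by linarith, by linarith⟩
  have hψ : ContDiff ℝ ∞ (ψ : ℝ → ℝ) := ψ.contDiff
  have hψ0 : ∀ r : ℝ, r ≤ G x₀ / 2 → ψ r = 0 := fun r hr => by
    refine ψ.zero_of_le_dist ?_
    rw [Real.dist_eq, abs_sub_comm]
    exact le_trans (by show G x₀ / 2 ≤ _; linarith) (le_abs_self _)
  have hψ1 : ∀ r : ℝ, 3 * G x₀ / 2 ≤ r → ψ r = 0 := fun r hr => by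
    refine ψ.zero_of_le_dist ?_
    rw [Real.dist_eq]
    exact le_trans (by show G x₀ / 2 ≤ _; linarith) (le_abs_self _)
  have hψnear : ∀ᶠ x in nhds (0 : E3), ψ (G x) = 0 := by
    have : ∀ᶠ x in nhds (0 : E3), G x < G x₀ / 2 :=
      hcont.continuousAt.eventually (gt_mem_nhds (by rw [hG0]; linarith))
    filter_upwards [this] with x hx using hψ0 _ hx.le
  have hcutC : ∀ f : E3 → ℝ, HasCompactSupport fun x => ψ (G x) * f x := by
    intro f
    have h1 : ∀ᶠ x in Filter.cocompact E3, 3 * G x₀ / 2 ≤ G x := hcoer.eventually_ge_atTop _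
    obtain ⟨C, hC, hCs⟩ := Filter.mem_cocompact.mp h1
    refine HasCompactSupport.intro hC fun x hx => ?_
    have : 3 * G x₀ / 2 ≤ G x := hCs hx
    simp [hψ1 _ this]
  have hcutS : ∀ f : E3 → ℝ, SmoothOffZero f → ContDiff ℝ ∞ fun x => ψ (G x) * f x := by
    intro f hf
    rw [contDiff_iff_contDiffAt]
    intro x
    by_cases hx : x = 0
    · subst hx
      refine (contDiffAt_const (c := (0 : ℝ))).congr_of_eventuallyEq ?_
      filter_upwards [hψnear] with y hy
      simp [hy]
    · exact (hψ.contDiffAt.comp x (hG x hx)).mul (hf x hx)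
  -- the derivative of the cut-off does not contribute, as the field is tangential to the level sets
  have hW := fun i => smoothOffZero_hessGrad (K := K) hG m i
  have hdiv : ∀ x, ∑ i, partialDeriv i (fun y => ψ (G y) * hessGrad G K m i y) x
      = ψ (G x) * q x := by
    intro x
    by_cases hx : x = 0
    · subst hx
      have : ∀ i, partialDeriv i (fun y => ψ (G y) * hessGrad G K m i y) 0 = 0 := fun i => by
        have : (fun y => ψ (G y) * hessGrad G K m i y) =ᶠ[nhds 0] fun _ => (0 : ℝ) := by
          filter_upwards [hψnear] with y hy
          simp [hy]
        simp [partialDeriv, this.fderiv_eq]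
      simp [this, hψnear.self_of_nhds]
    · have hGd := hG.differentiableAt hx
      have hψd : DifferentiableAt ℝ (ψ : ℝ → ℝ) (G x) := hψ.differentiable (by simp) _
      have hcomp : ∀ i, partialDeriv i (fun y => ψ (G y)) x
          = deriv ψ (G x) * partialDeriv i G x := fun i => by
        have := (hψd.hasDerivAt.comp_hasFDerivAt x hGd.hasFDerivAt).fderiv
        simp only [partialDeriv]
        change (fderiv ℝ ((ψ : ℝ → ℝ) ∘ G) x) _ = _
        rw [this]
        simp
      have h1 : ∀ i, partialDeriv i (fun y => ψ (G y) * hessGrad G K m i y) x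
          = deriv ψ (G x) * (partialDeriv i G x * hessGrad G K m i x)
            + ψ (G x) * partialDeriv i (hessGrad G K m i) x := fun i => by
        have hψG : DifferentiableAt ℝ (fun y => ψ (G y)) x := hψd.comp x hGd
        rw [partialDeriv_mul i hψG ((hW i).differentiableAt hx), hcomp]
        ring
      simp only [h1, Finset.sum_add_distrib, ← Finset.mul_sum]
      rw [sum_partialDeriv_mul_hessGrad hG hK hom hdet m hx,
        sum_partialDeriv_hessGrad hG hK hdet m hx]
      simp [q]
  -- the divergence theorem
  have hint : ∫ x, ψ (G x) * q x = 0 := by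
    simp only [← hdiv]
    rw [MeasureTheory.integral_finsetSum]
    · refine Finset.sum_eq_zero fun i _ => ?_
      exact integral_partialDeriv_eq_zero ((hcutS _ (hW i)).of_le (by simp)) (hcutC _) i
    · intro i _
      refine Continuous.integrable_of_hasCompactSupport ?_ ?_
      · exact ((hcutS _ (hW i)).continuous_fderiv (by simp)).clm_apply continuous_const
      · exact (hcutC _).fderiv_apply (𝕜 := ℝ) (v := (EuclideanSpace.single i 1 : E3))
  have hnn : 0 ≤ fun x => ψ (G x) * q x := fun x => by
    by_cases hx : x = 0
    · simp [hx, hψnear.self_of_nhds]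
    · exact mul_nonneg ψ.nonneg (hq x hx).1
  have hcts := (hcutS q hqs).continuous
  have hae := (MeasureTheory.integral_eq_zero_iff_of_nonneg hnn
    (hcts.integrable_of_hasCompactSupport (hcutC q))).mp hint
  have hzero := (hcts.ae_eq_iff_eq MeasureTheory.volume continuous_const).mp hae
  have h0 : ψ (G x₀) * q x₀ = 0 := congrFun hzero x₀
  have hψx : ψ (G x₀) = 1 := ψ.one_of_mem_closedBall (by simp [ψ]; linarith)
  rw [hψx, one_mul] at h0
  exact (hq x₀ hx₀).2 h0

end Deicke

/-! ### The energy of a norm -/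

/-- The energy `N² / 2`, whose Hessian is the fundamental tensor of the norm. -/
noncomputable def energy (N : Seminorm ℝ E3) (x : E3) : ℝ := N x ^ 2 / 2

namespace IsLocalParam

variable {S : Set E3} {U : Set E2} {φ : E2 → E3}

lemma mem (h : IsLocalParam S U φ) {u : E2} (hu : u ∈ U) : φ u ∈ S := by
  obtain ⟨V, -, hV⟩ := h.image
  exact (hV ▸ Set.mem_image_of_mem φ hu : φ u ∈ S ∩ V).1

lemma contDiffAt (h : IsLocalParam S U φ) {u : E2} (hu : u ∈ U) : ContDiffAt ℝ ∞ φ u :=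
  h.smooth.contDiffAt (h.isOpen.mem_nhds hu)

lemma hasFDerivAt (h : IsLocalParam S U φ) {u : E2} (hu : u ∈ U) :
    HasFDerivAt φ (fderiv ℝ φ u) u :=
  ((h.contDiffAt hu).differentiableAt (by simp)).hasFDerivAt

end IsLocalParam

lemma Seminorm.continuous_E3 (N : Seminorm ℝ E3) : Continuous N := by
  have h := N.convexOn.continuousOn isOpen_univ
  exact continuousOn_univ.mp h

section Norm

variable {N : Seminorm ℝ E3}

lemma continuous_energy (N : Seminorm ℝ E3) : Continuous (energy N) :=
  (N.continuous_E3.pow 2).div_const 2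

lemma energy_smul (N : Seminorm ℝ E3) (t : ℝ) (x : E3) : energy N (t • x) = t ^ 2 * energy N x := by
  simp [energy, map_smul_eq_mul, mul_pow]
  ring

lemma IsAdmissibleNorm.pos (hN : IsAdmissibleNorm N) {x : E3} (hx : x ≠ 0) : 0 < N x :=
  (apply_nonneg N x).lt_of_ne fun h => hx (hN.definite x h.symm)

lemma ne_zero_of_mem_unitSphere {p : E3} (hp : p ∈ unitSphere N) : p ≠ 0 := by
  rintro rfl
  simp [unitSphere] at hp

lemma IsAdmissibleNorm.inv_smul_mem (hN : IsAdmissibleNorm N) {x : E3} (hx : x ≠ 0) :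
    (N x)⁻¹ • x ∈ unitSphere N := by
  simp [unitSphere, map_smul_eq_mul, abs_of_pos (hN.pos hx), (hN.pos hx).ne']

lemma IsAdmissibleNorm.energy_pos (hN : IsAdmissibleNorm N) {x : E3} (hx : x ≠ 0) :
    0 < energy N x := by
  have := hN.pos hx
  unfold energy
  positivity

lemma IsAdmissibleNorm.tendsto_energy (hN : IsAdmissibleNorm N) :
    Filter.Tendsto (energy N) (Filter.cocompact E3) Filter.atTop := by
  have hne : (Metric.sphere (0 : E3) 1).Nonempty := NormedSpace.sphere_nonempty.mpr zero_le_one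
  obtain ⟨y, hy, hmin⟩ := (isCompact_sphere (0 : E3) 1).exists_isMinOn hne
    (continuous_energy N).continuousOn
  have hy0 : y ≠ 0 := by
    rintro rfl
    simp at hy
  have hle : ∀ x, energy N y * ‖x‖ ^ 2 ≤ energy N x := by
    intro x
    by_cases hx : x = 0
    · simp [hx, energy]
    · have hmem : ‖x‖⁻¹ • x ∈ Metric.sphere (0 : E3) 1 := by
        simp [norm_smul, hx]
      have h : energy N y ≤ energy N (‖x‖⁻¹ • x) := hmin hmem
      rw [energy_smul, inv_pow, ← div_eq_inv_mul] at h
      exact (le_div_iff₀ (by positivity)).mp h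
  refine Filter.tendsto_atTop_mono hle ?_
  exact ((Filter.tendsto_pow_atTop two_ne_zero).comp
    (tendsto_norm_cocompact_atTop (E := E3))).const_mul_atTop (hN.energy_pos hy0)

/-- The unit sphere of a norm is transversal to the radial direction. -/
lemma notMem_tangentPlane {U : Set E2} {φ : E2 → E3} (h : IsLocalParam (unitSphere N) U φ)
    {u : E2} (hu : u ∈ U) : φ u ∉ tangentPlane φ u := by
  rintro ⟨v, hv⟩
  obtain ⟨C, hC, hbound⟩ := Seminorm.bound_of_continuous_normedSpace N N.continuous_E3
  have hline : HasDerivAt (fun s : ℝ => u + s • v) v 0 := by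
    simpa using ((hasDerivAt_id (0 : ℝ)).smul_const v).const_add u
  have hγ : HasDerivAt (fun s : ℝ => φ (u + s • v)) (φ u) 0 := by
    have h1 : HasFDerivAt φ (fderiv ℝ φ u) (u + (0 : ℝ) • v) := by simpa using h.hasFDerivAt hu
    have h2 := h1.comp_hasDerivAt (0 : ℝ) hline
    have hv' : fderiv ℝ φ u v = φ u := hv
    rw [hv'] at h2
    exact h2
  have hU : ∀ᶠ s : ℝ in nhds 0, u + s • v ∈ U :=
    hline.continuousAt.eventually (h.isOpen.mem_nhds (by simpa using hu))
  have hlo := (hasDerivAt_iff_isLittleO.mp hγ).def (c := (2 * C)⁻¹) (by positivity)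
  -- along a curve with velocity `φ u` the norm would have to grow at unit rate
  have hev : ∀ᶠ s : ℝ in nhds 0, s ≤ 0 := by
    filter_upwards [hU, hlo] with s hs hs'
    by_contra! hpos
    have e1 : N (φ (u + s • v)) = 1 := h.mem hs
    have e0 : N (φ u) = 1 := h.mem hu
    simp only [zero_smul, add_zero, sub_zero] at hs'
    set d := φ (u + s • v) - φ u - s • φ u with hd
    have e2 : (1 + s) • φ u = φ (u + s • v) - d := by
      rw [hd]; module
    have e3 : N ((1 + s) • φ u) ≤ 1 + N d := by
      rw [e2, ← e1]; exact map_sub_le_add N _ _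
    rw [map_smul_eq_mul, e0, Real.norm_of_nonneg (by linarith)] at e3
    have e4 : N d ≤ C * ((2 * C)⁻¹ * s) := (hbound d).trans (by
      rw [Real.norm_of_nonneg hpos.le] at hs'
      gcongr)
    have e5 : C * ((2 * C)⁻¹ * s) = s / 2 := by field_simp
    linarith
  obtain ⟨ε, hε, hball⟩ := Metric.eventually_nhds_iff.mp hev
  have := hball (y := ε / 2) (by simp [abs_of_pos hε]; linarith)
  linarith

/-- An admissible norm is smooth off the origin: the map `(u, t) ↦ t φ(u)` is a local
diffeomorphism, and the norm is the `t`-component of its inverse. -/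
lemma IsAdmissibleNorm.smoothOffZero (hN : IsAdmissibleNorm N) : SmoothOffZero N := by
  intro x hx
  have hxpos := hN.pos hx
  obtain ⟨U, φ, h, u, hu, hux⟩ := hN.smooth _ (hN.inv_smul_mem hx)
  let Φ : E2 × ℝ → E3 := fun z => z.2 • φ z.1
  have hΦx : Φ (u, N x) = x := by
    simp [Φ, hux, smul_smul, hxpos.ne']
  have hΦ : ContDiffAt ℝ ∞ Φ (u, N x) :=
    contDiffAt_snd.smul ((h.contDiffAt hu).comp (u, N x) contDiffAt_fst)
  let D : E2 × ℝ →L[ℝ] E3 := fderiv ℝ Φ (u, N x)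
  have hD : ∀ v s, D (v, s) = N x • fderiv ℝ φ u v + s • φ u := by
    intro v s
    have h1 : HasFDerivAt (fun z : E2 × ℝ => φ z.1)
        ((fderiv ℝ φ u).comp (ContinuousLinearMap.fst ℝ E2 ℝ)) (u, N x) :=
      HasFDerivAt.comp (u, N x) (h.hasFDerivAt hu) hasFDerivAt_fst
    have h2 : HasFDerivAt (fun z : E2 × ℝ => z.2) (ContinuousLinearMap.snd ℝ E2 ℝ) (u, N x) :=
      hasFDerivAt_snd
    have h3 := (h2.smul h1).fderiv
    simp only [D]
    change fderiv ℝ ((fun z : E2 × ℝ => z.2) • fun z : E2 × ℝ => φ z.1) (u, N x) (v, s) = _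
    rw [h3]
    simp
  have hinj : Function.Injective D := by
    rw [injective_iff_map_eq_zero]
    rintro ⟨v, s⟩ hvs
    rw [hD] at hvs
    have hs : s = 0 := by
      by_contra hs
      refine notMem_tangentPlane h hu ⟨-(s⁻¹ * N x) • v, ?_⟩
      have : s⁻¹ • (N x • fderiv ℝ φ u v + s • φ u) = 0 := by rw [hvs, smul_zero]
      rw [smul_add, smul_smul, smul_smul, inv_mul_cancel₀ hs, one_smul] at this
      rw [ContinuousLinearMap.coe_coe, map_smul, neg_smul, neg_eq_iff_add_eq_zero]
      exact this
    subst hs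
    rw [zero_smul, add_zero, smul_eq_zero_iff_right hxpos.ne'] at hvs
    have : v = 0 := h.immersion u hu (by simpa using hvs)
    simp [this]
  have hfin : Module.finrank ℝ (E2 × ℝ) = Module.finrank ℝ E3 := by simp
  let e : (E2 × ℝ) ≃L[ℝ] E3 :=
    (LinearEquiv.ofInjectiveOfFinrankEq (D : E2 × ℝ →ₗ[ℝ] E3) hinj hfin).toContinuousLinearEquiv
  have he : HasFDerivAt Φ (e : E2 × ℝ →L[ℝ] E3) (u, N x) := by
    have : (e : E2 × ℝ →L[ℝ] E3) = D := ContinuousLinearMap.ext fun z => rfl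
    rw [this]
    exact (hΦ.differentiableAt (by simp)).hasFDerivAt
  have hstrict := hΦ.hasStrictFDerivAt' he (by simp)
  have hloc : ContDiffAt ℝ ∞ (hΦ.localInverse he (by simp)) x := by
    have := hΦ.to_localInverse he (by simp)
    rwa [hΦx] at this
  have himg : hΦ.localInverse he (by simp) x = (u, N x) := by
    have := hΦ.localInverse_apply_image he (by simp)
    rwa [hΦx] at this
  have hright : ∀ᶠ y in nhds x, Φ (hΦ.localInverse he (by simp) y) = y := by
    have := hstrict.eventually_right_inverse
    rwa [hΦx] at this
  have hmem : ∀ᶠ y in nhds x, (hΦ.localInverse he (by simp) y).1 ∈ U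
      ∧ 0 < (hΦ.localInverse he (by simp) y).2 := by
    have hopen : IsOpen (U ×ˢ Set.Ioi (0 : ℝ)) := h.isOpen.prod isOpen_Ioi
    refine hloc.continuousAt.eventually (hopen.mem_nhds ?_)
    rw [himg]
    exact ⟨hu, hxpos⟩
  refine hloc.snd.congr_of_eventuallyEq ?_
  filter_upwards [hright, hmem] with y hy hy'
  have h1 : N (φ (hΦ.localInverse he (by simp) y).1) = 1 := h.mem hy'.1
  conv_lhs => rw [← hy]
  simp only [Φ, map_smul_eq_mul, h1, mul_one]
  exact Real.norm_of_nonneg hy'.2.le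

lemma IsAdmissibleNorm.smoothOffZero_energy (hN : IsAdmissibleNorm N) :
    SmoothOffZero (energy N) := fun x hx => ((hN.smoothOffZero x hx).pow 2).div_const 2

lemma IsAdmissibleNorm.fderiv_energy_apply_self (hN : IsAdmissibleNorm N) {x : E3} (hx : x ≠ 0) :
    fderiv ℝ (energy N) x x = N x ^ 2 := by
  rw [fderiv_apply_self_of_homogeneous (n := 2) (hN.smoothOffZero_energy.differentiableAt hx)
    fun t _ => energy_smul N t x]
  simp only [energy]
  push_cast
  ring

lemma IsAdmissibleNorm.fderiv_energy_apply_self_of_mem (hN : IsAdmissibleNorm N) {p : E3}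
    (hp : p ∈ unitSphere N) : fderiv ℝ (energy N) p p = 1 := by
  rw [hN.fderiv_energy_apply_self (ne_zero_of_mem_unitSphere hp), show N p = 1 from hp, one_pow]

lemma hasDerivAt_line (x v : E3) (s : ℝ) : HasDerivAt (fun s : ℝ => x + s • v) v s := by
  simpa using ((hasDerivAt_id s).smul_const v).const_add x

lemma IsAdmissibleNorm.hasDerivAt_energy_line (hN : IsAdmissibleNorm N) {x v : E3} {s : ℝ}
    (hx : x + s • v ≠ 0) : HasDerivAt (fun s : ℝ => energy N (x + s • v))
      (fderiv ℝ (energy N) (x + s • v) v) s := by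
  have h := (hN.smoothOffZero_energy.differentiableAt hx).hasFDerivAt
  exact h.comp_hasDerivAt s (hasDerivAt_line x v s)

lemma IsAdmissibleNorm.differentiableAt_fderiv_energy (hN : IsAdmissibleNorm N) {x : E3}
    (hx : x ≠ 0) : DifferentiableAt ℝ (fderiv ℝ (energy N)) x :=
  ((hN.smoothOffZero_energy x hx).fderiv_right (m := ∞) (by simp)).differentiableAt (by simp)

lemma IsAdmissibleNorm.hasDerivAt_fderiv_energy_line (hN : IsAdmissibleNorm N) {x v : E3} {s : ℝ}
    (hx : x + s • v ≠ 0) (w : E3) : HasDerivAt (fun s : ℝ => fderiv ℝ (energy N) (x + s • v) w)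
      (fderiv ℝ (fderiv ℝ (energy N)) (x + s • v) v w) s := by
  have h := (hN.differentiableAt_fderiv_energy hx).hasFDerivAt
  have h' := h.comp_hasDerivAt s (hasDerivAt_line x v s)
  exact h'.clm_apply (hasDerivAt_const s w) |>.congr_deriv (by simp)

/-- The Cauchy–Schwarz inequality for the duality map of the norm. -/
lemma IsAdmissibleNorm.fderiv_energy_le (hN : IsAdmissibleNorm N) {x : E3} (hx : x ≠ 0) (y : E3) :
    fderiv ℝ (energy N) x y ≤ N x * N y := by
  have h : HasDerivAt (fun s : ℝ => energy N (x + s • y)) (fderiv ℝ (energy N) x y) 0 := by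
    simpa using hN.hasDerivAt_energy_line (x := x) (v := y) (s := 0) (by simpa using hx)
  have hslope := h.tendsto_slope_zero_right
  have hbound : Filter.Tendsto (fun s : ℝ => N x * N y + s * (N y ^ 2 / 2)) 
      (nhdsWithin 0 (Set.Ioi 0)) (nhds (N x * N y)) := by
    have : Continuous fun s : ℝ => N x * N y + s * (N y ^ 2 / 2) := by fun_prop
    simpa using (this.tendsto 0).mono_left nhdsWithin_le_nhds
  refine le_of_tendsto_of_tendsto hslope hbound ?_
  filter_upwards [self_mem_nhdsWithin] with s hs
  have hs : 0 < s := hs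
  have h1 : N (x + s • y) ≤ N x + s * N y := by
    refine (map_add_le_add N _ _).trans ?_
    rw [map_smul_eq_mul, Real.norm_of_nonneg hs.le]
  have h2 : energy N (x + s • y) ≤ (N x + s * N y) ^ 2 / 2 := by
    unfold energy
    gcongr
  have h3 : energy N (x + s • y) - energy N x ≤ s * (N x * N y + s * (N y ^ 2 / 2)) := by
    refine (sub_le_sub_right h2 _).trans (le_of_eq ?_)
    unfold energy
    ring
  simp only [zero_add, zero_smul, add_zero, smul_eq_mul]
  exact (inv_mul_le_iff₀ hs).mpr h3

/-- The Hessian of the energy is positive semidefinite: the differential is a monotone map. -/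
lemma IsAdmissibleNorm.fderiv_fderiv_energy_nonneg (hN : IsAdmissibleNorm N) {x : E3} (hx : x ≠ 0)
    (v : E3) : 0 ≤ fderiv ℝ (fderiv ℝ (energy N)) x v v := by
  have h : HasDerivAt (fun s : ℝ => fderiv ℝ (energy N) (x + s • v) v)
      (fderiv ℝ (fderiv ℝ (energy N)) x v v) 0 := by
    simpa using hN.hasDerivAt_fderiv_energy_line (x := x) (v := v) (s := 0) (by simpa using hx) v
  refine ge_of_tendsto h.tendsto_slope_zero_right ?_
  have hev : ∀ᶠ s : ℝ in nhds 0, x + s • v ≠ 0 :=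
    (hasDerivAt_line x v 0).continuousAt.eventually_ne (by simpa using hx)
  filter_upwards [self_mem_nhdsWithin, nhdsWithin_le_nhds hev] with s hs hne
  have hs : 0 < s := hs
  simp only [zero_add, zero_smul, add_zero, smul_eq_mul]
  set y := x + s • v with hy
  have h1 := hN.fderiv_energy_le hx y
  have h2 := hN.fderiv_energy_le hne x
  have h3 := hN.fderiv_energy_apply_self hx
  have h4 := hN.fderiv_energy_apply_self hne
  have h5 : s * (fderiv ℝ (energy N) y v - fderiv ℝ (energy N) x v)
      = fderiv ℝ (energy N) y y - fderiv ℝ (energy N) y x - fderiv ℝ (energy N) x y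
        + fderiv ℝ (energy N) x x := by
    have hsv : s • v = y - x := by rw [hy]; abel
    rw [mul_sub, ← smul_eq_mul, ← smul_eq_mul, ← map_smul, ← map_smul, hsv, map_sub, map_sub]
    ring
  have h6 : 0 ≤ s * (fderiv ℝ (energy N) y v - fderiv ℝ (energy N) x v) := by
    rw [h5, h3, h4]
    nlinarith [sq_nonneg (N x - N y)]
  exact mul_nonneg (inv_nonneg.mpr hs.le) (nonneg_of_mul_nonneg_right h6 hs)

end Norm

/-! ### Tangent planes and the second fundamental form -/

lemma E3.bilin_apply_eq_sum (H : E3 →L[ℝ] E3 →L[ℝ] ℝ) (x y : E3) :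
    H x y = ∑ i, ∑ j, x i * H (EuclideanSpace.single i 1) (EuclideanSpace.single j 1) * y j := by
  conv_lhs => rw [← E3.sum_smul_single x, ← E3.sum_smul_single y]
  simp only [Fin.sum_univ_three, map_add, map_smul, add_apply, smul_apply, smul_eq_mul]
  ring

/-- For a vector `p` with `H p p = 1` which is `H`-orthogonal to `a` and `b`, the Gram determinant of
`a, b` equals that of `a, b, p`, which is `det H` times a squared volume. -/
lemma det_gram_eq (H : E3 →L[ℝ] E3 →L[ℝ] ℝ) {a b p : E3} (hap : H a p = 0) (hbp : H b p = 0)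
    (hpp : H p p = 1) (hpa : H p a = 0) (hpb : H p b = 0) :
    (!![H a a, H a b; H b a, H b b]).det
      = (Matrix.of fun i j : Fin 3 =>
          H (EuclideanSpace.single i 1) (EuclideanSpace.single j 1)).det * det3 a b p ^ 2 := by
  set M : Matrix (Fin 3) (Fin 3) ℝ := Matrix.of fun i j : Fin 3 =>
    H (EuclideanSpace.single i 1) (EuclideanSpace.single j 1) with hM
  set P : Matrix (Fin 3) (Fin 3) ℝ := Matrix.of ![a.ofLp, b.ofLp, p.ofLp] with hP
  have hgram : P * M * P.transpose
      = !![H a a, H a b, H a p; H b a, H b b, H b p; H p a, H p b, H p p] := by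
    have key : ∀ x y : Fin 3 → ℝ, ∀ i j, P i = x → P j = y →
        (P * M * P.transpose) i j = H (WithLp.toLp 2 x) (WithLp.toLp 2 y) := by
      intro x y i j hx hy
      subst hx hy
      rw [E3.bilin_apply_eq_sum]
      simp only [Matrix.mul_apply, Matrix.transpose_apply, Fin.sum_univ_three, hM, Matrix.of_apply]
      ring
    ext i j
    rw [key _ _ i j rfl rfl]
    fin_cases i <;> fin_cases j <;> rfl
  have hdet := congrArg Matrix.det hgram
  rw [Matrix.det_mul, Matrix.det_mul, Matrix.det_transpose, hap, hbp, hpp, hpa, hpb] at hdet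
  have h3 : (!![H a a, H a b, 0; H b a, H b b, 0; 0, 0, 1]).det
      = H a a * H b b - H a b * H b a := by
    simp [Matrix.det_fin_three]
  rw [show det3 a b p = P.det from rfl, Matrix.det_fin_two_of, ← h3, ← hdet]
  ring

section Norm

variable {N : Seminorm ℝ E3} {U : Set E2} {φ : E2 → E3} {u : E2}

lemma mem_tangentPlane {w : E3} : w ∈ tangentPlane φ u ↔ ∃ v, fderiv ℝ φ u v = w := Iff.rfl

lemma fderiv_energy_param (hN : IsAdmissibleNorm N) (h : IsLocalParam (unitSphere N) U φ)
    (hu : u ∈ U) (v : E2) : fderiv ℝ (energy N) (φ u) (fderiv ℝ φ u v) = 0 := by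
  have h0 := ne_zero_of_mem_unitSphere (h.mem hu)
  have h1 : HasFDerivAt (fun u => energy N (φ u))
      ((fderiv ℝ (energy N) (φ u)).comp (fderiv ℝ φ u)) u :=
    (hN.smoothOffZero_energy.differentiableAt h0).hasFDerivAt.comp u (h.hasFDerivAt hu)
  have h2 : HasFDerivAt (fun u => energy N (φ u)) (0 : E2 →L[ℝ] ℝ) u := by
    refine (hasFDerivAt_const (1 / 2 : ℝ) u).congr_of_eventuallyEq ?_
    filter_upwards [h.isOpen.mem_nhds hu] with y hy
    have : N (φ y) = 1 := h.mem hy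
    simp [energy, this]
  exact congrArg (fun L : E2 →L[ℝ] ℝ => L v) (h1.unique h2)

/-- The tangent plane of the unit sphere is the kernel of the differential of the energy. -/
lemma mem_tangentPlane_iff (hN : IsAdmissibleNorm N) (h : IsLocalParam (unitSphere N) U φ)
    (hu : u ∈ U) {w : E3} : w ∈ tangentPlane φ u ↔ fderiv ℝ (energy N) (φ u) w = 0 := by
  let L : Module.Dual ℝ E3 := (fderiv ℝ (energy N) (φ u) : E3 →ₗ[ℝ] ℝ)
  have hL : L ≠ 0 := fun h0 => by
    have h1 := hN.fderiv_energy_apply_self_of_mem (h.mem hu)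
    have h2 : L (φ u) = 0 := by rw [h0]; rfl
    exact one_ne_zero (h1.symm.trans h2)
  have hle : tangentPlane φ u ≤ LinearMap.ker L := by
    rintro _ ⟨v, rfl⟩
    exact fderiv_energy_param hN h hu v
  have h1 : Module.finrank ℝ (LinearMap.ker L) + 1 = 3 := by
    simpa using Module.Dual.finrank_ker_add_one_of_ne_zero hL
  have h2 : Module.finrank ℝ (tangentPlane φ u) = 2 := by
    rw [tangentPlane, LinearMap.finrank_range_of_inj (h.immersion u hu)]
    simp
  have heq := Submodule.eq_of_le_of_finrank_le hle (by omega)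
  rw [heq]
  exact Iff.rfl

/-- The second fundamental form of the unit sphere with respect to the differential of the energy
is the negative of the Hessian of the energy. -/
lemma fderiv_energy_secondDeriv (hN : IsAdmissibleNorm N) (h : IsLocalParam (unitSphere N) U φ)
    (hu : u ∈ U) (v w : E2) : fderiv ℝ (energy N) (φ u) (secondDeriv φ u v w)
      = -fderiv ℝ (fderiv ℝ (energy N)) (φ u) (fderiv ℝ φ u v) (fderiv ℝ φ u w) := by
  have h0 := ne_zero_of_mem_unitSphere (h.mem hu)
  have hd2 : DifferentiableAt ℝ (fderiv ℝ φ) u :=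
    ((h.contDiffAt hu).fderiv_right (m := ∞) (by simp)).differentiableAt (by simp)
  have h1 : HasFDerivAt (fun u => fderiv ℝ (energy N) (φ u))
      ((fderiv ℝ (fderiv ℝ (energy N)) (φ u)).comp (fderiv ℝ φ u)) u :=
    (hN.differentiableAt_fderiv_energy h0).hasFDerivAt.comp u (h.hasFDerivAt hu)
  have h2 := h1.clm_apply (hd2.hasFDerivAt.clm_apply (hasFDerivAt_const w u))
  have h3 : HasFDerivAt (fun u => fderiv ℝ (energy N) (φ u) (fderiv ℝ φ u w))
      (0 : E2 →L[ℝ] ℝ) u := by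
    refine (hasFDerivAt_const (0 : ℝ) u).congr_of_eventuallyEq ?_
    filter_upwards [h.isOpen.mem_nhds hu] with y hy using fderiv_energy_param hN h hy w
  have h4 := congrArg (fun L : E2 →L[ℝ] ℝ => L v) (h2.unique h3)
  simp at h4
  rw [secondDeriv]
  linarith

/-- The Gram determinant of the Hessian of the energy on a tangent plane. -/
lemma det_hess_tangent (hN : IsAdmissibleNorm N) (h : IsLocalParam (unitSphere N) U φ)
    (hu : u ∈ U) (v w : E2) :
    (!![fderiv ℝ (fderiv ℝ (energy N)) (φ u) (fderiv ℝ φ u v) (fderiv ℝ φ u v),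
        fderiv ℝ (fderiv ℝ (energy N)) (φ u) (fderiv ℝ φ u v) (fderiv ℝ φ u w);
        fderiv ℝ (fderiv ℝ (energy N)) (φ u) (fderiv ℝ φ u w) (fderiv ℝ φ u v),
        fderiv ℝ (fderiv ℝ (energy N)) (φ u) (fderiv ℝ φ u w) (fderiv ℝ φ u w)]).det
      = (hessMatrix (energy N) (φ u)).det
        * det3 (fderiv ℝ φ u v) (fderiv ℝ φ u w) (φ u) ^ 2 := by
  have h0 := ne_zero_of_mem_unitSphere (h.mem hu)
  have hsm := hN.smoothOffZero_energy
  have hself := fderiv_fderiv_apply_self hsm (fun t _ => energy_smul N t) h0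
  have hH : hessMatrix (energy N) (φ u) = Matrix.of fun i j : Fin 3 =>
      fderiv ℝ (fderiv ℝ (energy N)) (φ u) (EuclideanSpace.single i 1)
        (EuclideanSpace.single j 1) := by
    ext i j
    exact partialDeriv_partialDeriv hsm i j h0
  rw [hH]
  apply det_gram_eq
  · rw [hself, fderiv_energy_param hN h hu]
  · rw [hself, fderiv_energy_param hN h hu]
  · rw [hself, hN.fderiv_energy_apply_self_of_mem (h.mem hu)]
  · rw [fderiv_fderiv_symm hsm h0, hself, fderiv_energy_param hN h hu]
  · rw [fderiv_fderiv_symm hsm h0, hself, fderiv_energy_param hN h hu]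

lemma inner_cross3_left (a b : E3) : inner ℝ a (cross3 a b) = 0 := by
  simp [cross3, PiLp.inner_apply, Fin.sum_univ_three, cross_apply]
  ring

lemma inner_cross3_right (a b : E3) : inner ℝ b (cross3 a b) = 0 := by
  simp [cross3, PiLp.inner_apply, Fin.sum_univ_three, cross_apply]
  ring

lemma inner_fderiv_unitNormal (φ : E2 → E3) (u v : E2) :
    inner ℝ (fderiv ℝ φ u v) (unitNormal φ u) = 0 := by
  have hv : v = v 0 • coordVec 0 + v 1 • coordVec 1 := by
    ext i
    fin_cases i <;> simp [coordVec]
  rw [hv, unitNormal]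
  simp [inner_add_left, inner_smul_left, inner_smul_right, inner_cross3_left, inner_cross3_right]

/-- Nonvanishing Gaussian curvature makes the Hessian of the energy nondegenerate. -/
lemma det_hessMatrix_energy_ne_zero (hN : IsAdmissibleNorm N) {p : E3} (hp : p ∈ unitSphere N) :
    (hessMatrix (energy N) p).det ≠ 0 := by
  obtain ⟨U, φ, h, u, hu, rfl⟩ := hN.smooth p hp
  intro hdet
  have hcurv := hN.curvature_pos U φ h u hu
  have hB := det_hess_tangent hN h hu (coordVec 0) (coordVec 1)
  rw [hdet, zero_mul] at hB
  -- the Euclidean normal covector is a multiple of the differential of the energy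
  have hn : ∀ X : E3, inner ℝ X (unitNormal φ u)
      = inner ℝ (φ u) (unitNormal φ u) * fderiv ℝ (energy N) (φ u) X := by
    intro X
    have hmem : X - fderiv ℝ (energy N) (φ u) X • φ u ∈ tangentPlane φ u := by
      rw [mem_tangentPlane_iff hN h hu]
      simp [hN.fderiv_energy_apply_self_of_mem (h.mem hu)]
    obtain ⟨v, hv⟩ := hmem
    have h1 := inner_fderiv_unitNormal φ u v
    rw [show fderiv ℝ φ u v = _ from hv, inner_sub_left, real_inner_smul_left] at h1
    linarith
  have hform : ∀ i j, secondForm φ u i j = inner ℝ (φ u) (unitNormal φ u)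
      * -fderiv ℝ (fderiv ℝ (energy N)) (φ u) (fderiv ℝ φ u (coordVec i))
        (fderiv ℝ φ u (coordVec j)) := fun i j => by
    rw [← fderiv_energy_secondDeriv hN h hu]
    exact hn _
  have hII : (secondForm φ u).det = 0 := by
    rw [Matrix.det_fin_two] at hB ⊢
    simp only [hform]
    simp only [Matrix.of_apply, Matrix.cons_val] at hB
    linear_combination (inner ℝ (φ u) (unitNormal φ u)) ^ 2 * hB
  rw [gaussianCurvature, hII, zero_div] at hcurv
  exact lt_irrefl _ hcurv

lemma hessMatrix_energy_smul (hN : IsAdmissibleNorm N) {t : ℝ} (ht : 0 < t) {x : E3} (hx : x ≠ 0) :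
    hessMatrix (energy N) (t • x) = hessMatrix (energy N) x := by
  have hsm := hN.smoothOffZero_energy
  ext i j
  simp only [hessMatrix_apply, partialDeriv_partialDeriv hsm _ _ hx,
    partialDeriv_partialDeriv hsm _ _ (smul_ne_zero ht.ne' hx),
    fderiv_fderiv_smul_of_homogeneous hsm (fun t _ => energy_smul N t) ht hx]

lemma sum_mul_hessMatrix_mul {f : E3 → ℝ} (hf : SmoothOffZero f) {x : E3} (hx : x ≠ 0)
    (v w : E3) : ∑ i, ∑ j, v i * hessMatrix f x i j * w j = fderiv ℝ (fderiv ℝ f) x v w := by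
  simp only [E3.bilin_apply_eq_sum _ v w, hessMatrix_apply, partialDeriv_partialDeriv hf _ _ hx]

lemma posDef_hessMatrix_energy (hN : IsAdmissibleNorm N) {x : E3} (hx : x ≠ 0) :
    (hessMatrix (energy N) x).PosDef := by
  have hsm := hN.smoothOffZero_energy
  have hPSD : (hessMatrix (energy N) x).PosSemidef := by
    refine .of_dotProduct_mulVec_nonneg ?_ fun v => ?_
    · rw [Matrix.IsHermitian, Matrix.conjTranspose_eq_transpose_of_trivial]
      exact hessMatrix_isSymm hsm hx
    · have h1 := hN.fderiv_fderiv_energy_nonneg hx (WithLp.toLp 2 v)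
      rw [← sum_mul_hessMatrix_mul hsm hx] at h1
      refine h1.trans (le_of_eq ?_)
      simp only [dotProduct, Matrix.mulVec, Finset.mul_sum, mul_assoc, star_trivial]
  have hdet : (hessMatrix (energy N) x).det ≠ 0 := by
    rw [← hessMatrix_energy_smul hN (inv_pos.mpr (hN.pos hx)) hx]
    exact det_hessMatrix_energy_ne_zero hN (hN.inv_smul_mem hx)
  exact hPSD.posDef_iff_isUnit.mpr ((Matrix.isUnit_iff_isUnit_det _).mpr hdet.isUnit)

lemma fderiv_fderiv_energy_pos (hN : IsAdmissibleNorm N) {x : E3} (hx : x ≠ 0) {v : E3}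
    (hv : v ≠ 0) : 0 < fderiv ℝ (fderiv ℝ (energy N)) x v v := by
  rw [← sum_mul_hessMatrix_mul hN.smoothOffZero_energy hx]
  have h := (posDef_hessMatrix_energy hN hx).dotProduct_mulVec_pos (x := v.ofLp) (by simpa using hv)
  refine h.trans_eq ?_
  simp only [dotProduct, Matrix.mulVec, Finset.mul_sum, mul_assoc, star_trivial]

/-! ### Birkhoff normal fields -/

lemma isBirkhoffNormalField_id (hN : IsAdmissibleNorm N) :
    IsBirkhoffNormalField N (unitSphere N) fun p => p where
  continuousOn := continuousOn_id
  unit _ hp := hp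
  orthogonal U φ h u hu w hw t := by
    have hp : N (φ u) = 1 := h.mem hu
    have h1 := hN.fderiv_energy_le (ne_zero_of_mem_unitSphere (h.mem hu)) (φ u + t • w)
    rw [map_add, map_smul, (mem_tangentPlane_iff hN h hu).mp hw, smul_zero, add_zero,
      hN.fderiv_energy_apply_self_of_mem (h.mem hu), hp, one_mul] at h1
    rwa [hp]

/-- Strict convexity of the unit ball: a supporting plane touches it in one point. -/
lemma eq_of_fderiv_energy_eq_one (hN : IsAdmissibleNorm N) {p q : E3} (hp : p ∈ unitSphere N)
    (hq : q ∈ unitSphere N) (h : fderiv ℝ (energy N) p q = 1) : q = p := by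
  by_contra hne
  have hv : q - p ≠ 0 := sub_ne_zero.mpr hne
  have hp1 : N p = 1 := hp
  have hq1 : N q = 1 := hq
  -- the segment from `p` to `q` lies in the unit sphere
  have hseg : ∀ s ∈ Set.Ioo (0 : ℝ) 1, N (p + s • (q - p)) = 1 := by
    intro s hs
    refine le_antisymm ?_ ?_
    · have : p + s • (q - p) = (1 - s) • p + s • q := by module
      rw [this]
      refine (map_add_le_add N _ _).trans ?_
      rw [map_smul_eq_mul, map_smul_eq_mul, Real.norm_of_nonneg hs.1.le,
        Real.norm_of_nonneg (by linarith [hs.2]), hp1, hq1]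
      linarith
    · have h1 := hN.fderiv_energy_le (ne_zero_of_mem_unitSphere hp) (p + s • (q - p))
      rw [map_add, map_smul, map_sub, h, hN.fderiv_energy_apply_self_of_mem hp, hp1] at h1
      simpa using h1
  have hne0 : ∀ s ∈ Set.Ioo (0 : ℝ) 1, p + s • (q - p) ≠ 0 := fun s hs =>
    ne_zero_of_mem_unitSphere (hseg s hs)
  have hfirst : ∀ s ∈ Set.Ioo (0 : ℝ) 1, fderiv ℝ (energy N) (p + s • (q - p)) (q - p) = 0 := by
    intro s hs
    refine (hN.hasDerivAt_energy_line (hne0 s hs)).unique ?_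
    refine (hasDerivAt_const s (1 / 2 : ℝ)).congr_of_eventuallyEq ?_
    filter_upwards [Ioo_mem_nhds hs.1 hs.2] with s' hs'
    simp [energy, hseg s' hs']
  have hhalf : (1 / 2 : ℝ) ∈ Set.Ioo (0 : ℝ) 1 := by norm_num
  have hsecond : fderiv ℝ (fderiv ℝ (energy N)) (p + (1 / 2 : ℝ) • (q - p))
      (q - p) (q - p) = 0 := by
    refine (hN.hasDerivAt_fderiv_energy_line (hne0 _ hhalf) (q - p)).unique ?_
    refine (hasDerivAt_const (1 / 2 : ℝ) (0 : ℝ)).congr_of_eventuallyEq ?_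
    filter_upwards [Ioo_mem_nhds hhalf.1 hhalf.2] with s' hs' using hfirst s' hs'
  exact (fderiv_fderiv_energy_pos hN (hne0 _ hhalf) hv).ne' hsecond

lemma neg_mem_unitSphere {q : E3} (hq : q ∈ unitSphere N) : -q ∈ unitSphere N := by
  have hq1 : N q = 1 := hq
  simp [unitSphere, map_neg_eq_map, hq1]

/-- A unit vector which is Birkhoff orthogonal to the tangent plane at `p` is `p` or `-p`. -/
lemma eq_or_eq_neg_of_birkhoffOrthogonal (hN : IsAdmissibleNorm N)
    (h : IsLocalParam (unitSphere N) U φ) (hu : u ∈ U) {q : E3} (hq : q ∈ unitSphere N)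
    (hort : BirkhoffOrthogonal N q (tangentPlane φ u)) : q = φ u ∨ q = -φ u := by
  have hp := h.mem hu
  have hp1 : N (φ u) = 1 := hp
  have hq1 : N q = 1 := hq
  have hq0 := ne_zero_of_mem_unitSphere hq
  have hker : ∀ w ∈ tangentPlane φ u, fderiv ℝ (energy N) q w = 0 := by
    intro w hw
    have hd : HasDerivAt (fun s : ℝ => energy N (q + s • w)) (fderiv ℝ (energy N) q w) 0 := by
      simpa using hN.hasDerivAt_energy_line (x := q) (v := w) (s := 0) (by simpa using hq0)
    refine IsLocalMin.hasDerivAt_eq_zero ?_ hd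
    refine Filter.Eventually.of_forall fun s => ?_
    have := hort w hw s
    simp only [zero_smul, add_zero, energy]
    gcongr
  -- the differentials at `q` and at `φ u` are proportional
  have hprop : ∀ X, fderiv ℝ (energy N) q X
      = fderiv ℝ (energy N) q (φ u) * fderiv ℝ (energy N) (φ u) X := by
    intro X
    have hmem : X - fderiv ℝ (energy N) (φ u) X • φ u ∈ tangentPlane φ u := by
      rw [mem_tangentPlane_iff hN h hu]
      simp [hN.fderiv_energy_apply_self_of_mem hp]
    have := hker _ hmem
    rw [map_sub, map_smul, smul_eq_mul] at this
    linarith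
  have hprod := hprop q
  rw [hN.fderiv_energy_apply_self_of_mem hq] at hprod
  have b1 := hN.fderiv_energy_le hq0 (φ u)
  have b2 := hN.fderiv_energy_le hq0 (-φ u)
  have b3 := hN.fderiv_energy_le (ne_zero_of_mem_unitSphere hp) q
  have b4 := hN.fderiv_energy_le (ne_zero_of_mem_unitSphere hp) (-q)
  rw [map_neg, map_neg_eq_map] at b2 b4
  rw [hp1, hq1, mul_one] at b1 b2 b3 b4
  set α := fderiv ℝ (energy N) q (φ u)
  set β := fderiv ℝ (energy N) (φ u) q with hβ
  rcases le_total 0 β with hs | hs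
  · left
    exact eq_of_fderiv_energy_eq_one hN hp hq (by rw [← hβ]; nlinarith)
  · right
    have : -q = φ u := eq_of_fderiv_energy_eq_one hN hp (neg_mem_unitSphere hq)
      (by rw [map_neg, ← hβ]; nlinarith)
    rw [← this, neg_neg]

lemma isPreconnected_unitSphere (hN : IsAdmissibleNorm N) : IsPreconnected (unitSphere N) := by
  have hc : IsPreconnected ({0}ᶜ : Set E3) :=
    (isConnected_compl_singleton_of_one_lt_rank (by
      rw [← Module.finrank_eq_rank]; simp) 0).isPreconnected
  have himg : (fun x : E3 => (N x)⁻¹ • x) '' {0}ᶜ = unitSphere N := by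
    ext p
    constructor
    · rintro ⟨x, hx, rfl⟩
      exact hN.inv_smul_mem hx
    · intro hp
      have hp1 : N p = 1 := hp
      exact ⟨p, ne_zero_of_mem_unitSphere hp, by simp [hp1]⟩
  rw [← himg]
  have hinv : ContinuousOn (fun x => (N x)⁻¹) ({0}ᶜ : Set E3) :=
    N.continuous_E3.continuousOn.inv₀ fun x hx => (hN.pos hx).ne'
  exact hc.image _ (hinv.smul continuousOn_id)

/-- The only Birkhoff normal fields of the unit sphere are the position vector and its negative. -/
lemma IsBirkhoffNormalField.eq_id_or_eq_neg (hN : IsAdmissibleNorm N) {η : E3 → E3}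
    (hη : IsBirkhoffNormalField N (unitSphere N) η) :
    (∀ p ∈ unitSphere N, η p = p) ∨ ∀ p ∈ unitSphere N, η p = -p := by
  have hpt : ∀ p ∈ unitSphere N, η p = p ∨ η p = -p := by
    intro p hp
    obtain ⟨U, φ, h, u, hu, rfl⟩ := hN.smooth p hp
    exact eq_or_eq_neg_of_birkhoffOrthogonal hN h hu (hη.unit _ hp) (hη.orthogonal U φ h u hu)
  by_contra! hcon
  obtain ⟨⟨p, hp, hpη⟩, p', hp', hpη'⟩ := hcon
  have h1 : η p = -p := (hpt p hp).resolve_left hpη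
  have h2 : η p' = p' := (hpt p' hp').resolve_right hpη'
  have hcont : ContinuousOn (fun x => inner ℝ (η x) x) (unitSphere N) :=
    hη.continuousOn.inner continuousOn_id
  have hivt := (isPreconnected_unitSphere hN).intermediate_value hp hp' hcont
  obtain ⟨x, hx, hx0⟩ := hivt (show (0 : ℝ) ∈ _ by
    constructor
    · simp [h1]
    · simp [h2])
  have hne := ne_zero_of_mem_unitSphere hx
  rcases hpt x hx with h | h
  · simp [h, hne] at hx0
  · simp [h, hne] at hx0

end Norm

/-! ### Affine normal fields proportional to the position vector -/

section Norm

variable {N : Seminorm ℝ E3}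

lemma det3_smul_right (a b c : E3) (s : ℝ) : det3 a b (s • c) = s * det3 a b c := by
  simp [det3, Matrix.det_fin_three]
  ring

/-- With the transversal field `s p` the affine fundamental form is `-s⁻¹` times the Hessian of the
energy. -/
lemma IsAffineFundamentalForm.apply_eq (hN : IsAdmissibleNorm N) {U : Set E2} {φ : E2 → E3}
    {u : E2} (hφ : IsLocalParam (unitSphere N) U φ) (hu : u ∈ U) {ζ : E3 → E3} {s : ℝ} (hs : s ≠ 0)
    (hζ : ζ (φ u) = s • φ u) {h : LinearMap.BilinForm ℝ E2}
    (hh : IsAffineFundamentalForm φ ζ u h) (v w : E2) :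
    h v w = -s⁻¹ * fderiv ℝ (fderiv ℝ (energy N)) (φ u) (fderiv ℝ φ u v) (fderiv ℝ φ u w) := by
  have h1 := (mem_tangentPlane_iff hN hφ hu).mp (hh v w)
  rw [hζ, map_sub, map_smul, map_smul, fderiv_energy_secondDeriv hN hφ hu,
    hN.fderiv_energy_apply_self_of_mem (hφ.mem hu)] at h1
  simp only [smul_eq_mul, mul_one] at h1
  field_simp
  linarith

lemma det_neg_inv_mul (s a b c d : ℝ) :
    (!![-s⁻¹ * a, -s⁻¹ * b; -s⁻¹ * c, -s⁻¹ * d]).det = (s⁻¹) ^ 2 * (!![a, b; c, d]).det := by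
  simp only [Matrix.det_fin_two_of]
  ring

/-- The multiple `s p` of the position vector is an affine normal field if and only if the
Hessian determinant of the energy is `s⁴`. -/
lemma isAffineNormalField_iff_det (hN : IsAdmissibleNorm N) {ζ : E3 → E3} {s : ℝ} (hs : s ≠ 0)
    (hζ : ∀ p ∈ unitSphere N, ζ p = s • p) : IsAffineNormalField (unitSphere N) ζ ↔
      ∀ p ∈ unitSphere N, (hessMatrix (energy N) p).det = s ^ 4 := by
  constructor
  · intro hA p hp
    obtain ⟨U, φ, hφ, u, hu, rfl⟩ := hN.smooth p hp
    obtain ⟨h, hh, hvol⟩ := hA.volume U φ hφ u hu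
    have hv := hvol (coordVec 0) (coordVec 1)
    have happ := hh.apply_eq hN hφ hu hs (hζ _ hp)
    simp only [happ] at hv
    rw [det_neg_inv_mul, det_hess_tangent hN hφ hu, hζ _ hp, det3_smul_right] at hv
    set d := det3 (fderiv ℝ φ u (coordVec 0)) (fderiv ℝ φ u (coordVec 1)) (φ u) with hd
    have hpos := (posDef_hessMatrix_energy hN (ne_zero_of_mem_unitSphere hp)).det_pos
    have hsq := congrArg (· ^ 2) hv
    simp only [sq_abs] at hsq
    rw [Real.sq_sqrt (abs_nonneg _), abs_of_nonneg (by positivity)] at hsq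
    -- the coordinate vectors and the position vector form a basis
    have hd0 : d ≠ 0 := by
      intro h0
      have hli : ¬ LinearIndependent ℝ ![(fderiv ℝ φ u (coordVec 0)).ofLp,
          (fderiv ℝ φ u (coordVec 1)).ofLp, (φ u).ofLp] := by
        intro hli
        have := (Matrix.linearIndependent_rows_iff_isUnit (A := Matrix.of
          ![(fderiv ℝ φ u (coordVec 0)).ofLp, (fderiv ℝ φ u (coordVec 1)).ofLp, (φ u).ofLp])).mp hli
        rw [Matrix.isUnit_iff_isUnit_det] at this
        exact this.ne_zero h0
      apply hli
      rw [Fintype.linearIndependent_iff]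
      intro g hg
      have hg' : g 0 • fderiv ℝ φ u (coordVec 0) + g 1 • fderiv ℝ φ u (coordVec 1) + g 2 • φ u
          = 0 := by
        rw [Fin.sum_univ_three] at hg
        ext i
        simpa using congrFun hg i
      have h2 := congrArg (fderiv ℝ (energy N) (φ u)) hg'
      rw [map_add, map_add, map_smul, map_smul, map_smul, fderiv_energy_param hN hφ hu,
        fderiv_energy_param hN hφ hu, hN.fderiv_energy_apply_self_of_mem hp, map_zero] at h2
      simp only [smul_eq_mul, mul_zero, zero_add, mul_one] at h2
      rw [h2, zero_smul, add_zero, ← map_smul, ← map_smul, ← map_add] at hg'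
      have h01 : g 0 • coordVec 0 + g 1 • coordVec 1 = 0 :=
        hφ.immersion u hu (by rw [hg', map_zero])
      have e0 := congrArg (fun x : E2 => x 0) h01
      have e1 := congrArg (fun x : E2 => x 1) h01
      simp [coordVec] at e0 e1
      intro i
      fin_cases i
      exacts [e0, e1, h2]
    have h3 : (s * d) ^ 2 * s ^ 2 = (hessMatrix (energy N) (φ u)).det * d ^ 2 := by
      rw [hsq]
      field_simp
    have h4 : d ^ 2 * (s ^ 4 - (hessMatrix (energy N) (φ u)).det) = 0 := by
      linear_combination h3
    rcases mul_eq_zero.mp h4 with h5 | h5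
    · exact absurd h5 (pow_ne_zero 2 hd0)
    · linarith
  · intro hdet
    refine ⟨fun U φ hφ => ?_, fun U φ hφ u hu => ?_, fun U φ hφ u hu v => ?_,
      fun U φ hφ u hu => ?_⟩
    · have h1 : ContDiffOn ℝ ∞ (fun u => s • φ u) U := hφ.smooth.const_smul s
      exact h1.congr fun u hu => hζ _ (hφ.mem hu)
    · rw [hζ _ (hφ.mem hu), Submodule.smul_mem_iff _ hs]
      exact notMem_tangentPlane hφ hu
    · have h1 : (ζ ∘ φ) =ᶠ[nhds u] fun u => s • φ u := by
        filter_upwards [hφ.isOpen.mem_nhds hu] with y hy using hζ _ (hφ.mem hy)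
      have h2 : HasFDerivAt (fun u => s • φ u) (s • fderiv ℝ φ u) u :=
        (hφ.hasFDerivAt hu).const_smul s
      rw [h1.fderiv_eq, h2.fderiv, mem_tangentPlane]
      exact ⟨s • v, by simp⟩
    · -- the affine fundamental form of `s p`
      let B : LinearMap.BilinForm ℝ E2 := LinearMap.mk₂ ℝ
        (fun v w => -s⁻¹ * fderiv ℝ (fderiv ℝ (energy N)) (φ u) (fderiv ℝ φ u v) (fderiv ℝ φ u w))
        (fun _ _ _ => by simp; ring) (fun _ _ _ => by simp; ring) (fun _ _ _ => by simp; ring)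
        (fun _ _ _ => by simp; ring)
      have hB : ∀ v w, B v w = -s⁻¹ * fderiv ℝ (fderiv ℝ (energy N)) (φ u) (fderiv ℝ φ u v)
        (fderiv ℝ φ u w) := fun _ _ => rfl
      refine ⟨B, fun v w => ?_, fun v w => ?_⟩
      · -- the Gauss equation, tested against the differential of the energy
        rw [mem_tangentPlane_iff hN hφ hu, hζ _ (hφ.mem hu), map_sub, map_smul, map_smul,
          fderiv_energy_secondDeriv hN hφ hu, hN.fderiv_energy_apply_self_of_mem (hφ.mem hu), hB]
        simp only [smul_eq_mul]
        field_simp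
        ring
      · simp only [hB]
        rw [det_neg_inv_mul, det_hess_tangent hN hφ hu, hζ _ (hφ.mem hu), det3_smul_right,
          hdet _ (hφ.mem hu)]
        set d := det3 (fderiv ℝ φ u v) (fderiv ℝ φ u w) (φ u)
        rw [show (s⁻¹) ^ 2 * (s ^ 4 * d ^ 2) = (s * d) ^ 2 by field_simp,
          abs_sq, Real.sqrt_sq_eq_abs]

/-! ### Norms with constant Hessian determinant -/

/-- If the Hessian determinant of the energy is constant on the unit sphere, the Hessian itself is
constant. -/
lemma fderiv_fderiv_energy_eq (hN : IsAdmissibleNorm N) {K : ℝ} (hK : K ≠ 0)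
    (hdet : ∀ p ∈ unitSphere N, (hessMatrix (energy N) p).det = K) {x y : E3} (hx : x ≠ 0)
    (hy : y ≠ 0) : fderiv ℝ (fderiv ℝ (energy N)) x = fderiv ℝ (fderiv ℝ (energy N)) y := by
  have hsm := hN.smoothOffZero_energy
  have hdet' : ∀ z, z ≠ 0 → (hessMatrix (energy N) z).det = K := fun z hz => by
    rw [← hessMatrix_energy_smul hN (inv_pos.mpr (hN.pos hz)) hz]
    exact hdet _ (hN.inv_smul_mem hz)
  have hzero := fun m z (hz : z ≠ 0) => matDeriv_hessMatrix_eq_zero hsm (continuous_energy N)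
    hN.tendsto_energy (fun z hz => hN.energy_pos hz) (fun t _ => energy_smul N t)
    (fun z hz => posDef_hessMatrix_energy hN hz) hK hdet' m hz
  have hconn : IsPreconnected ({0}ᶜ : Set E3) :=
    (isConnected_compl_singleton_of_one_lt_rank (by
      rw [← Module.finrank_eq_rank]; simp) 0).isPreconnected
  have hH : ∀ i j, hessMatrix (energy N) x i j = hessMatrix (energy N) y i j := by
    intro i j
    have hs := matSmooth_hessMatrix hsm i j
    refine isOpen_compl_singleton.is_const_of_fderiv_eq_zero hconn
      (fun z hz => (hs.differentiableAt hz).differentiableWithinAt) (fun z hz => ?_) hx hy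
    ext v
    rw [← sum_mul_partialDeriv]
    refine Finset.sum_eq_zero fun m _ => ?_
    have : matDeriv m (hessMatrix (energy N)) z i j = 0 := by rw [hzero m z hz]; rfl
    rw [show partialDeriv m (fun y => hessMatrix (energy N) y i j) z = 0 from this, mul_zero]
  ext v w
  rw [← sum_mul_hessMatrix_mul hsm hx, ← sum_mul_hessMatrix_mul hsm hy]
  simp only [hH]

lemma exists_core_of_det_eq (hN : IsAdmissibleNorm N) {K : ℝ} (hK : K ≠ 0)
    (hdet : ∀ p ∈ unitSphere N, (hessMatrix (energy N) p).det = K) :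
    ∃ c : InnerProductSpace.Core ℝ E3, IsNormOf c N ∧ gramDet c = K := by
  have hsm := hN.smoothOffZero_energy
  obtain ⟨x₀, hx₀⟩ := exists_ne (0 : E3)
  set p := (N x₀)⁻¹ • x₀
  have hp : p ∈ unitSphere N := hN.inv_smul_mem hx₀
  have hp0 := ne_zero_of_mem_unitSphere hp
  set H := fderiv ℝ (fderiv ℝ (energy N)) p with hH
  let c : InnerProductSpace.Core ℝ E3 :=
    { inner := fun v w => H v w
      conj_inner_symm := fun v w => fderiv_fderiv_symm hsm hp0 w v
      re_inner_nonneg := fun v => hN.fderiv_fderiv_energy_nonneg hp0 v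
      add_left := fun v w z => by simp
      smul_left := fun v w r => by simp
      definite := fun v hv => by
        by_contra hne
        exact (fderiv_fderiv_energy_pos hN hp0 hne).ne' hv }
  refine ⟨c, fun x => ?_, ?_⟩
  · change N x = √(H x x)
    by_cases hx : x = 0
    · simp [hx]
    · rw [hH, fderiv_fderiv_energy_eq hN hK hdet hp0 hx,
        fderiv_fderiv_apply_self hsm (fun t _ => energy_smul N t) hx,
        hN.fderiv_energy_apply_self hx, Real.sqrt_sq (apply_nonneg N x)]
  · rw [← hdet p hp]
    unfold gramDet
    congr 1
    ext i j
    exact (partialDeriv_partialDeriv hsm i j hp0).symm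

lemma InnerProductSpace.Core.real_inner_comm (c : InnerProductSpace.Core ℝ E3) (x y : E3) :
    c.inner x y = c.inner y x := c.conj_inner_symm y x

/-- The inner product of `c` as a continuous bilinear map. -/
noncomputable def InnerProductSpace.Core.toBilin (c : InnerProductSpace.Core ℝ E3) :
    E3 →L[ℝ] E3 →L[ℝ] ℝ :=
  LinearMap.toContinuousLinearMap (LinearMap.toContinuousLinearMap.toLinearMap ∘ₗ
    LinearMap.mk₂ ℝ (fun x y => c.inner x y) c.add_left (fun r x y => c.smul_left x y r)
      (fun x y z => by
        rw [c.real_inner_comm x, c.add_left, c.real_inner_comm y, c.real_inner_comm z])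
      (fun r x y => by
        rw [c.real_inner_comm x, c.smul_left, c.real_inner_comm y]; rfl))

lemma hessMatrix_energy_of_isNormOf {c : InnerProductSpace.Core ℝ E3} (hc : IsNormOf c N) (p : E3) :
    (hessMatrix (energy N) p).det = gramDet c := by
  have happ : ∀ x y, c.toBilin x y = c.inner x y := fun _ _ => rfl
  have hE : energy N = fun x => c.toBilin x x / 2 := by
    ext x
    have h0 : 0 ≤ c.inner x x := c.re_inner_nonneg x
    rw [energy, hc x, Real.sq_sqrt h0, happ]
  have h1 : ∀ x, HasFDerivAt (energy N) (c.toBilin x) x := by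
    intro x
    rw [hE]
    have h := ((c.toBilin.hasFDerivAt (x := x)).clm_apply (hasFDerivAt_id x)).mul_const (1 / 2 : ℝ)
    convert! h using 1
    · ext y
      simp
      ring
    · ext y
      simp [happ, c.real_inner_comm y x]
      ring
  have h2 : ∀ i j, partialDeriv i (partialDeriv j (energy N)) p
      = c.inner (EuclideanSpace.single i 1) (EuclideanSpace.single j 1) := by
    intro i j
    have h3 : partialDeriv j (energy N)
        = fun x => c.toBilin x (EuclideanSpace.single j 1) := by
      ext x
      rw [partialDeriv, (h1 x).fderiv]
    have h4 := (c.toBilin.hasFDerivAt (x := p)).clm_apply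
      (hasFDerivAt_const (EuclideanSpace.single j 1 : E3) p)
    rw [h3, partialDeriv, h4.fderiv]
    simp [happ]
  unfold gramDet
  congr 1
  ext i j
  exact h2 i j

/-- The multiple `s p` of the position vector is an affine normal field if and only if the norm
is derived from an inner product of Gram determinant `s⁴`. -/
lemma isAffineNormalField_iff_exists_core (hN : IsAdmissibleNorm N) {ζ : E3 → E3} {s : ℝ}
    (hs : s ≠ 0) (hζ : ∀ p ∈ unitSphere N, ζ p = s • p) :
    IsAffineNormalField (unitSphere N) ζ ↔
      ∃ c : InnerProductSpace.Core ℝ E3, IsNormOf c N ∧ gramDet c = s ^ 4 := by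
  rw [isAffineNormalField_iff_det hN hs hζ]
  refine ⟨exists_core_of_det_eq hN (pow_ne_zero 4 hs), ?_⟩
  rintro ⟨c, hc, hdet⟩ p -
  rw [hessMatrix_energy_of_isNormOf hc, hdet]

end Norm

theorem theorem4p2 (N : Seminorm ℝ E3) (hN : IsAdmissibleNorm N) :
    IsBirkhoffNormalField N (unitSphere N) (fun p => p) ∧
    ∀ η : E3 → E3, IsBirkhoffNormalField N (unitSphere N) η →
      (IsAffineNormalField (unitSphere N) η ↔
        ∃ c : InnerProductSpace.Core ℝ E3, IsNormOf c N ∧ gramDet c = 1) ∧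
      ((∃ r : ℝ, 0 < r ∧ IsAffineNormalField (unitSphere N) (fun p => r • η p)) ↔
        ∃ c : InnerProductSpace.Core ℝ E3, IsNormOf c N) := by
  refine ⟨isBirkhoffNormalField_id hN, fun η hη => ?_⟩
  obtain ⟨ε, hε, hηε⟩ : ∃ ε : ℝ, ε ^ 2 = 1 ∧ ∀ p ∈ unitSphere N, η p = ε • p := by
    rcases hη.eq_id_or_eq_neg hN with h | h
    · exact ⟨1, by norm_num, fun p hp => by rw [h p hp, one_smul]⟩
    · exact ⟨-1, by norm_num, fun p hp => by rw [h p hp, neg_one_smul]⟩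
  have hε4 : ε ^ 4 = 1 := by linear_combination (ε ^ 2 + 1) * hε
  have hε0 : ε ≠ 0 := by
    rintro rfl
    norm_num at hε
  have hr : ∀ r : ℝ, 0 < r → (IsAffineNormalField (unitSphere N) (fun p => r • η p) ↔
      ∃ c : InnerProductSpace.Core ℝ E3, IsNormOf c N ∧ gramDet c = r ^ 4) := by
    intro r hr
    have h := isAffineNormalField_iff_exists_core hN (ζ := fun p => r • η p)
      (mul_ne_zero hr.ne' hε0) fun p hp => by rw [hηε p hp, smul_smul]
    rwa [mul_pow, hε4, mul_one] at h
  constructor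
  · have h := isAffineNormalField_iff_exists_core hN hε0 hηε
    rwa [hε4] at h
  · constructor
    · rintro ⟨r, hr0, hA⟩
      obtain ⟨c, hc, -⟩ := (hr r hr0).mp hA
      exact ⟨c, hc⟩
    · rintro ⟨c, hc⟩
      obtain ⟨x, hx⟩ := exists_ne (0 : E3)
      have hpos : 0 < gramDet c := by
        rw [← hessMatrix_energy_of_isNormOf hc x]
        exact (posDef_hessMatrix_energy hN hx).det_pos
      refine ⟨√√(gramDet c), by positivity, (hr _ (by positivity)).mpr ⟨c, hc, ?_⟩⟩
      rw [show (4 : ℕ) = 2 * 2 from rfl, pow_mul, Real.sq_sqrt (by positivity),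
        Real.sq_sqrt hpos.le]
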